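/- **Setting.** Let $n,m\ge 0$, $\epsilon,\gamma,\nu>0$, and fix a field of coefficients for homology. Let $\Theta=(W_1,W_2)$ with $W_1\in\mathbb R^{n\times m}$, $W_2\in\mathbb R^{m\times n}$, and let $\mathrm{Emb}(\Theta)=\{p_1,\dots,p_n\}\subset\mathbb R^m$ be the rows of $W_1$. For a family of insertion times of the edges on $n$ vertices, the Vietoris–Rips complex of parameter $\rho\ge 0$ consists of the simplices all of whose edges are inserted at time at most $\rho$ (vertices at time $0$), and its persistence diagram is the multiset of pairs $(\text{birth},\text{death})$ with birth $<$ death $<\infty$ of all homological features, in all degrees. $\mathrm{PD}(\mathrm{Emb}(\Theta))$ is the diagram for the insertion times $\|p_i-p_j\|$; for a graph $G=(V,E,w)$ on $n$ vertices with symmetric weights $w\ge 0$, $\mathrm{PD}(G)$ is the diagram for the insertion times $(w(u,v)+\gamma)^{-\nu}$, $u\ne v$. For $x=(b,d)$ put $p_\partial(x)=(\frac{b+d}2,\frac{b+d}2)$. For finite multisets $\alpha=\{x_i\}_{i=1}^N$ and $\beta=\{y_j\}_{j=1}^M$ of points of $\Omega=\{(b,d):b<d\}$ let $\mathbf a_i=\|x_i-p_\partial(x_i)\|^2$,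 $\mathbf b_j=\|y_j-p_\partial(y_j)\|^2$, $\mathrm{pers}(\alpha)=\sum_i\mathbf a_i$, $\mathrm{pers}(\beta)=\sum_j\mathbf b_j$, let $\Pi$ be the set of nonnegative $N\times M$ matrices with row and column sums at most $1$, and $$\mathrm{FG}_\epsilon(\alpha,\beta)=\inf_{P\in\Pi}\Big[\sum_{i,j}\|x_i-y_j\|^2P_{ij}+\sum_i\mathbf a_i\big(1-\sum_jP_{ij}\big)+\sum_j\mathbf b_j\big(1-\sum_iP_{ij}\big)+\tfrac\epsilon2\mathrm{KL}\big(P\big|\tfrac{\mathbf a\mathbf b^T}{\mathrm{pers}(\alpha)}\big)+\tfrac\epsilon2\mathrm{KL}\big(P\big|\tfrac{\mathbf a\mathbf b^T}{\mathrm{pers}(\beta)}\big)\Big],$$ where $\mathrm{KL}(A|B)=\sum_{i,j}\big(A_{ij}\log(A_{ij}/B_{ij})-A_{ij}+B_{ij}\big)$ and $0\log 0=0$. Let $\mathrm{SFG}_\epsilon(\alpha,\beta)=\mathrm{FG}_\epsilon(\alpha,\beta)-\frac12\mathrm{FG}_\epsilon(\alpha,\alpha)-\frac12\mathrm{FG}_\epsilon(\beta,\beta)$.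 Let $P_{\alpha,\beta}$, $P_{\alpha,\alpha}$ be the optimal plans, $\mathbf M(P)=\sum_{i,j}P_{ij}$, $\mathbf M_i(P)=\sum_jP_{ij}$, let $T_{\alpha,\beta}(x_i)=2\big[(1-\mathbf M_i(P_{\alpha,\beta}))\,p_\partial(x_i)+\sum_j(P_{\alpha,\beta})_{ij}\,y_j\big]$, likewise $T_{\alpha,\alpha}$, and set $$\zeta_\epsilon(x_i)=T_{\alpha,\alpha}(x_i)-T_{\alpha,\beta}(x_i)+\epsilon\Big[\tfrac12\tfrac{d_i-b_i}{\mathrm{pers}(\alpha)}\big(\mathbf M(P_{\alpha,\beta})-\mathbf M(P_{\alpha,\alpha})\big)-\tfrac2{d_i-b_i}\big(\mathbf M_i(P_{\alpha,\beta})-\mathbf M_i(P_{\alpha,\alpha})\big)\Big]\begin{pmatrix}-1\\1\end{pmatrix}.$$ **General position.** Assume that $p_1,\dots,p_n$ are distinct and that, for every $x=(b_x,d_x)\in\mathrm{PD}(\mathrm{Emb}(\Theta))$, the death value $d_x$, and also the birth value $b_x$ if $b_x\neq0$, is the length of exactly one edge $\{p_i,p_j\}$. Denote these edges by $\{p^1_{d_x},p^2_{d_x}\}$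 and $\{p^1_{b_x},p^2_{b_x}\}$, and for $p\in\mathrm{Emb}(\Theta)$ put $$\frac{\partial b_x}{\partial p}=\frac{(\delta_{p,p^1_{b_x}}-\delta_{p,p^2_{b_x}})(p^1_{b_x}-p^2_{b_x})}{\|p^1_{b_x}-p^2_{b_x}\|}\ \ (=0\text{ if }b_x=0),\qquad \frac{\partial d_x}{\partial p}=\frac{(\delta_{p,p^1_{d_x}}-\delta_{p,p^2_{d_x}})(p^1_{d_x}-p^2_{d_x})}{\|p^1_{d_x}-p^2_{d_x}\|}.$$ **Theorem (Gradient of the topological loss term).** Let $\alpha=\mathrm{PD}(\mathrm{Emb}(\Theta))$, and let $\beta$ be either a nonempty finite multiset in $\Omega$ or $\beta=\mathrm{PD}(G)$ for a weighted graph $G$ on $n$ vertices. Then the optimal plans $P_{\alpha,\beta}$ and $P_{\alpha,\alpha}$ exist and are unique, and the loss $L_1=\mathrm{SFG}_\epsilon(\mathrm{PD}(\mathrm{Emb}(\Theta)),\beta)$ (so $L_1=L_1(G,\Theta)$ if $\beta=\mathrm{PD}(G)$) is, for each $p\in\mathrm{Emb}(\Theta)$, differentiable as a function of $p$, the other points being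 fixed, with gradient $$\frac{\partial L_1}{\partial p}=\sum_{x\in\mathrm{PD}(\mathrm{Emb}(\Theta))}\zeta_\epsilon(x)\cdot\frac{\partial x}{\partial p},\qquad \zeta_\epsilon(x)\cdot\frac{\partial x}{\partial p}=\zeta_\epsilon(x)_1\frac{\partial b_x}{\partial p}+\zeta_\epsilon(x)_2\frac{\partial d_x}{\partial p}.$$ -/

import Mathlib

namespace TopNode2vec

noncomputable section

/-! ### Persistent homology of Vietoris–Rips filtrations on the vertex set `Fin n` -/

/-- The Vietoris–Rips complex of parameter `ρ` for the insertion times `δ`: a nonempty set of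
vertices is a simplex iff all its pairs are inserted at time at most `ρ`. (For a point cloud
`δ` is the pairwise distance. Since `δ u u = 0` below, vertices are present from time `0` on.) -/
def VR {n : ℕ} (δ : Fin n → Fin n → ℝ) (ρ : ℝ) : PreAbstractSimplicialComplex (Fin n) where
  faces := {σ | σ.Nonempty ∧ ∀ u ∈ σ, ∀ v ∈ σ, δ u v ≤ ρ}
  isRelLowerSet_faces := fun _ hσ =>
    ⟨hσ.1, fun _ hτσ hτ => ⟨hτ, fun u hu v hv => hσ.2 u (hτσ hu) v (hτσ hv)⟩⟩

/-- The complex just before `ρ`, i.e. the union of the complexes `VR δ ρ'` for `ρ' < ρ`. -/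
def VRlt {n : ℕ} (δ : Fin n → Fin n → ℝ) (ρ : ℝ) : PreAbstractSimplicialComplex (Fin n) where
  faces := {σ | σ.Nonempty ∧ ∀ u ∈ σ, ∀ v ∈ σ, δ u v < ρ}
  isRelLowerSet_faces := fun _ hσ =>
    ⟨hσ.1, fun _ hτσ hτ => ⟨hτ, fun u hu v hv => hσ.2 u (hτσ hu) v (hτσ hv)⟩⟩

section Homology

variable (𝕜 : Type*) [Field 𝕜] {n : ℕ}

/-- The simplicial boundary map, on formal `𝕜`-linear combinations of finite vertex sets:
`∂σ = ∑_{v ∈ σ} (-1)^(position of v in σ) (σ ∖ {v})`, and `∂σ = 0` if `σ` is a vertex. -/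
def boundary : (Finset (Fin n) →₀ 𝕜) →ₗ[𝕜] (Finset (Fin n) →₀ 𝕜) :=
  Finsupp.linearCombination 𝕜 fun σ : Finset (Fin n) =>
    if 2 ≤ σ.card then
      ∑ v ∈ σ, Finsupp.single (σ.erase v) ((-1 : 𝕜) ^ (σ.filter (fun w => w < v)).card)
    else 0

/-- Simplicial `k`-chains of `K` with coefficients in `𝕜`. -/
def chains (K : PreAbstractSimplicialComplex (Fin n)) (k : ℕ) :
    Submodule 𝕜 (Finset (Fin n) →₀ 𝕜) :=
  Finsupp.supported 𝕜 𝕜 {σ : Finset (Fin n) | σ ∈ K ∧ σ.card = k + 1}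

/-- The `k`-cycles of `K`. -/
def cycles (K : PreAbstractSimplicialComplex (Fin n)) (k : ℕ) :
    Submodule 𝕜 (Finset (Fin n) →₀ 𝕜) :=
  chains 𝕜 K k ⊓ LinearMap.ker (boundary 𝕜)

/-- The `k`-boundaries of `K`. -/
def boundaries (K : PreAbstractSimplicialComplex (Fin n)) (k : ℕ) :
    Submodule 𝕜 (Finset (Fin n) →₀ 𝕜) :=
  (chains 𝕜 K (k + 1)).map (boundary 𝕜)

/-- The `k`-th persistent Betti number of a pair `K ≤ L`: the dimension of
the image of `Z_k(K)` modulo `B_k(L)`, i.e. of `Z_k(K) / (Z_k(K) ∩ B_k(L))`, the image of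
`H_k(K) → H_k(L)`. -/
def persistentBetti (k : ℕ) (K L : PreAbstractSimplicialComplex (Fin n)) : ℕ :=
  Module.finrank 𝕜 ((cycles 𝕜 K k).map (boundaries 𝕜 L k).mkQ)

/-- The number of `k`-dimensional features of the Vietoris–Rips filtration of `δ` that are born
exactly at `b` and die exactly at `d` (where `b < d`). -/
def multiplicity (δ : Fin n → Fin n → ℝ) (k : ℕ) (b d : ℝ) : ℕ :=
  ((persistentBetti 𝕜 k (VR δ b) (VRlt δ d) : ℤ) - persistentBetti 𝕜 k (VR δ b) (VR δ d)
    - persistentBetti 𝕜 k (VRlt δ b) (VRlt δ d)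
    + persistentBetti 𝕜 k (VRlt δ b) (VR δ d)).toNat

/-- The finitely many values at which the filtration can change. -/
def criticalValues (δ : Fin n → Fin n → ℝ) : Finset ℝ :=
  Finset.univ.image fun e : Fin n × Fin n => δ e.1 e.2

/-- The persistence diagram of the Vietoris–Rips filtration of `δ`: the multiset of all
`(birth, death)` with `birth < death < ∞`, over all homological degrees. -/
def PDof (δ : Fin n → Fin n → ℝ) : Multiset (ℝ × ℝ) :=
  ∑ k ∈ Finset.range n, ∑ b ∈ criticalValues δ, ∑ d ∈ (criticalValues δ).filter (fun d => b < d),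
    Multiset.replicate (multiplicity 𝕜 δ k b d) (b, d)

end Homology

/-- The persistence diagram of a point cloud `p_1, …, p_n` in `ℝ^m`. -/
def PD (𝕜 : Type*) [Field 𝕜] {n m : ℕ} (P : Fin n → EuclideanSpace ℝ (Fin m)) :
    Multiset (ℝ × ℝ) :=
  PDof 𝕜 fun i j => dist (P i) (P j)

/-- A weighted undirected graph on `n` ordered vertices, with edge set `V × V`. -/
structure WeightedGraph (n : ℕ) where
  w : Fin n → Fin n → ℝ
  nonneg : ∀ u v, 0 ≤ w u v
  symm : ∀ u v, w u v = w v u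

/-- The persistence diagram of a weighted graph: an edge `{u, v}` between distinct vertices is
inserted at time `1 / (w(u,v) + γ)^ν`. -/
def graphPD (𝕜 : Type*) [Field 𝕜] {n : ℕ} (γ ν : ℝ) (G : WeightedGraph n) :
    Multiset (ℝ × ℝ) :=
  PDof 𝕜 fun u v => if u = v then 0 else 1 / (G.w u v + γ) ^ ν

/-! ### Homogeneous entropic regularization of the diagram metric -/

/-- The open half-plane above the diagonal. -/
def Omega : Set (ℝ × ℝ) := {x | x.1 < x.2}

/-- Squared Euclidean distance in the plane. -/
def sqDist (x y : ℝ × ℝ) : ℝ := (x.1 - y.1) ^ 2 + (x.2 - y.2) ^ 2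

/-- Orthogonal projection to the diagonal. -/
def projDiag (x : ℝ × ℝ) : ℝ × ℝ := ((x.1 + x.2) / 2, (x.1 + x.2) / 2)

section Transport

variable {ι κ : Type*} [Fintype ι] [Fintype κ]

/-- Total persistence. -/
def pers (x : ι → ℝ × ℝ) : ℝ := ∑ i, sqDist (x i) (projDiag (x i))

/-- Matrices with nonnegative entries and row and column sums at most one. -/
def partialPlans (ι κ : Type*) [Fintype ι] [Fintype κ] : Set (Matrix ι κ ℝ) :=
  {P | (∀ i j, 0 ≤ P i j) ∧ (∀ j, ∑ i, P i j ≤ 1) ∧ ∀ i, ∑ j, P i j ≤ 1}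

/-- `KL(A | B) = ∑ A log (A / B) - A + B` (and `0 log 0 = 0`). -/
def KL (A B : Matrix ι κ ℝ) : ℝ :=
  ∑ i, ∑ j, (A i j * Real.log (A i j / B i j) - A i j + B i j)

/-- The matrix `a bᵀ / c`, with `a`, `b` the squared distances to the diagonal. -/
def refMatrix (x : ι → ℝ × ℝ) (y : κ → ℝ × ℝ) (c : ℝ) : Matrix ι κ ℝ :=
  fun i j => sqDist (x i) (projDiag (x i)) * sqDist (y j) (projDiag (y j)) / c

/-- The homogeneous entropic term. -/
def entropicTerm (x : ι → ℝ × ℝ) (y : κ → ℝ × ℝ) (P : Matrix ι κ ℝ) : ℝ :=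
  1 / 2 * (KL P (refMatrix x y (pers x)) + KL P (refMatrix x y (pers y)))

/-- The functional minimized in the regularized problem. -/
def objective (ε : ℝ) (x : ι → ℝ × ℝ) (y : κ → ℝ × ℝ) (P : Matrix ι κ ℝ) : ℝ :=
  (∑ i, ∑ j, sqDist (x i) (y j) * P i j)
    + (∑ i, sqDist (x i) (projDiag (x i)) * (1 - ∑ j, P i j))
    + (∑ j, sqDist (y j) (projDiag (y j)) * (1 - ∑ i, P i j))
    + ε * entropicTerm x y P

/-- The regularized transport cost of `∑ δ_{x_i}` and `∑ δ_{y_j}`. -/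
def FGfam (ε : ℝ) (x : ι → ℝ × ℝ) (y : κ → ℝ × ℝ) : ℝ :=
  sInf (objective ε x y '' partialPlans ι κ)

/-- `P` is an optimal partial transport plan for the regularized problem. -/
def IsOptimalPlan (ε : ℝ) (x : ι → ℝ × ℝ) (y : κ → ℝ × ℝ) (P : Matrix ι κ ℝ) : Prop :=
  P ∈ partialPlans ι κ ∧ ∀ P' ∈ partialPlans ι κ, objective ε x y P ≤ objective ε x y P'

/-- The optimal partial transport plan. -/
def optimalPlan (ε : ℝ) (x : ι → ℝ × ℝ) (y : κ → ℝ × ℝ) : Matrix ι κ ℝ :=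
  Classical.epsilon (IsOptimalPlan ε x y)

/-- Total mass of a plan. -/
def mass (P : Matrix ι κ ℝ) : ℝ := ∑ i, ∑ j, P i j

/-- Mass transported from the `i`-th point. -/
def rowMass (P : Matrix ι κ ℝ) (i : ι) : ℝ := ∑ j, P i j

/-- The barycentric map (with its factor two) evaluated at the `i`-th point. -/
def baryMap (ε : ℝ) (x : ι → ℝ × ℝ) (y : κ → ℝ × ℝ) (i : ι) : ℝ × ℝ :=
  (2 : ℝ) • ((1 - rowMass (optimalPlan ε x y) i) • projDiag (x i)
    + ∑ j, optimalPlan ε x y i j • y j)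

/-- The vector `K_i`. -/
def entropicCorrection (ε : ℝ) (x : ι → ℝ × ℝ) (y : κ → ℝ × ℝ) (i : ι) : ℝ × ℝ :=
  (1 / 2 * (((x i).2 - (x i).1) / pers x)
      * (mass (optimalPlan ε x y) - mass (optimalPlan ε x x))
    - 2 / ((x i).2 - (x i).1)
      * (rowMass (optimalPlan ε x y) i - rowMass (optimalPlan ε x x) i)) • ((-1 : ℝ), (1 : ℝ))

/-- The explicit gradient `x_i ↦ T_{α,α}(x_i) - T_{α,β}(x_i) + ε K_i` of the Sinkhorn
divergence. -/
def gradSFGfam (ε : ℝ) (x : ι → ℝ × ℝ) (y : κ → ℝ × ℝ) (i : ι) : ℝ × ℝ :=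
  baryMap ε x x i - baryMap ε x y i + ε • entropicCorrection ε x y i

end Transport

/-- The points of a multiset, as a family in which each point is listed with multiplicity. -/
def pts (α : Multiset (ℝ × ℝ)) : α → ℝ × ℝ := fun x => x.1

/-- The regularized cost between two diagrams. -/
def FG (ε : ℝ) (α β : Multiset (ℝ × ℝ)) : ℝ := FGfam ε (pts α) (pts β)

/-- The Sinkhorn divergence between two diagrams. -/
def SFG (ε : ℝ) (α β : Multiset (ℝ × ℝ)) : ℝ :=
  FG ε α β - 1 / 2 * FG ε α α - 1 / 2 * FG ε β β

/-- The map `ζ_ε` on the points of `α`. -/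
def zeta (ε : ℝ) (α β : Multiset (ℝ × ℝ)) : α → ℝ × ℝ := gradSFGfam ε (pts α) (pts β)

/-! ### The embedding and the topological loss -/

/-- The parameters `Θ = (W₁, W₂)` of the model. -/
structure Params (n m : ℕ) where
  W₁ : Matrix (Fin n) (Fin m) ℝ
  W₂ : Matrix (Fin m) (Fin n) ℝ

/-- The embedded points: the rows of `W₁`. -/
def Emb {n m : ℕ} (Θ : Params n m) : Fin n → EuclideanSpace ℝ (Fin m) :=
  fun i => WithLp.toLp 2 (Θ.W₁ i)

/-- The parameters obtained from `Θ` by moving the `i`-th embedded point to `q`. -/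
def Params.movePoint {n m : ℕ} (Θ : Params n m) (i : Fin n) (q : EuclideanSpace ℝ (Fin m)) :
    Params n m :=
  { Θ with W₁ := Θ.W₁.updateRow i q.ofLp }

/-- The topological loss against a fixed target diagram `β`. -/
def topLoss (𝕜 : Type*) [Field 𝕜] {n m : ℕ} (ε : ℝ) (β : Multiset (ℝ × ℝ)) (Θ : Params n m) : ℝ :=
  SFG ε (PD 𝕜 (Emb Θ)) β

/-- The topological loss term `L₁(G, Θ)`. -/
def L₁ (𝕜 : Type*) [Field 𝕜] {n m : ℕ} (ε γ ν : ℝ) (G : WeightedGraph n) (Θ : Params n m) : ℝ :=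
  SFG ε (PD 𝕜 (Emb Θ)) (graphPD 𝕜 γ ν G)

section Edges

variable (𝕜 : Type*) [Field 𝕜] {n m : ℕ} (P : Fin n → EuclideanSpace ℝ (Fin m))

/-- Vietoris–Rips general position: the points are distinct, and every nonzero birth value and
every death value occurring in the diagram is the length of only one edge. -/
def GeneralPosition : Prop :=
  Function.Injective P ∧ ∀ x ∈ PD 𝕜 P,
    (x.1 ≠ 0 → ∀ i j k l : Fin n, dist (P i) (P j) = x.1 → dist (P k) (P l) = x.1 →
      s(i, j) = s(k, l)) ∧
    (∀ i j k l : Fin n, dist (P i) (P j) = x.2 → dist (P k) (P l) = x.2 → s(i, j) = s(k, l))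

theorem mem_PDof {δ : Fin n → Fin n → ℝ} {x : ℝ × ℝ} (h : x ∈ PDof 𝕜 δ) :
    x.1 ∈ criticalValues δ ∧ x.2 ∈ criticalValues δ ∧ x.1 < x.2 := by
  unfold PDof at h
  simp only [Multiset.mem_sum, Finset.mem_filter] at h
  obtain ⟨k, -, b, hb, d, ⟨hd, hbd⟩, hx⟩ := h
  obtain rfl := Multiset.eq_of_mem_replicate hx
  exact ⟨hb, hd, hbd⟩

theorem exists_birthEdge (x : PD 𝕜 P) :
    ∃ e : Fin n × Fin n, dist (P e.1) (P e.2) = (pts (PD 𝕜 P) x).1 := by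
  have h := (mem_PDof 𝕜 (Multiset.coe_mem (x := x))).1
  simpa [criticalValues, pts] using h

theorem exists_deathEdge (x : PD 𝕜 P) :
    ∃ e : Fin n × Fin n, dist (P e.1) (P e.2) = (pts (PD 𝕜 P) x).2 := by
  have h := (mem_PDof 𝕜 (Multiset.coe_mem (x := x))).2.1
  simpa [criticalValues, pts] using h

/-- The endpoints of the edge whose length is the birth value of `x`; in general position it is
the longest edge of the simplex creating `x`. (If the birth value is `0`, the creating simplex is
a vertex and both endpoints agree for distinct points.) -/
def birthEdge (x : PD 𝕜 P) : Fin n × Fin n := (exists_birthEdge 𝕜 P x).choose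

/-- The endpoints of the edge whose length is the death value of `x`; in general position it is
the longest edge of the simplex that fills in `x`. -/
def deathEdge (x : PD 𝕜 P) : Fin n × Fin n := (exists_deathEdge 𝕜 P x).choose

/-- The vector `(δ_{p,p¹} - δ_{p,p²}) (p¹ - p²) / ‖p¹ - p²‖` for the edge `e = (p¹, p²)` and
`p = P i` (it is zero if both endpoints of `e` are the same). -/
def edgeGrad (e : Fin n × Fin n) (i : Fin n) : EuclideanSpace ℝ (Fin m) :=
  (((if i = e.1 then 1 else 0) - (if i = e.2 then 1 else 0) : ℝ) / ‖P e.1 - P e.2‖) •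
    (P e.1 - P e.2)

/-- `∑_x ζ_ε(x) · ∂x/∂p_i`, the sum over the points `x = (b, d)` of the diagram of the cloud, where
`∂x/∂p_i = (∂b/∂p_i, ∂d/∂p_i)`. -/
def lossGrad (ε : ℝ) (β : Multiset (ℝ × ℝ)) (i : Fin n) : EuclideanSpace ℝ (Fin m) :=
  ∑ x : PD 𝕜 P,
    ((zeta ε (PD 𝕜 P) β x).1 • edgeGrad P (birthEdge 𝕜 P x) i
      + (zeta ε (PD 𝕜 P) β x).2 • edgeGrad P (deathEdge 𝕜 P x) i)

end Edges

/-- The regularized problems defining `ζ_ε` have unique optimal plans. -/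
def HasUniquePlans (ε : ℝ) (α β : Multiset (ℝ × ℝ)) : Prop :=
  (∃! Q : Matrix α β ℝ, IsOptimalPlan ε (pts α) (pts β) Q) ∧
    ∃! Q : Matrix α α ℝ, IsOptimalPlan ε (pts α) (pts α) Q

end

end TopNode2vec

/-! Move one point from `p` to a nearby `q`. Strict inequalities between edge lengths persist, so
the diagram changes only by its points moving along and by ties breaking. General position excludes
ties at the positive birth values and at the death values of the diagram, and birth value `0`
belongs to vertices, so the existing points simply follow their edges
(`Refines.exists_PDof_eq_add`). Other ties may break and create new points. Both coordinates of a
new point come from lengths that agreed at `p`, so its squared distance to the diagonal is at most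
`2‖q - p‖²`.

The entropic term is homogeneous, so adding points to a diagram changes the cost by at most a
constant times their total persistence (`abs_FGfam_sumElim_sub_le`). The number of points is bounded
in terms of `n` alone, hence the new points contribute `O(‖q - p‖²)` and do not affect the
derivative.

What remains is a family of fixed size depending differentiably on `q`. Expanding the divergences
(`objective_eq`) writes the cost as an explicit function plus the minimum, over a fixed compact
convex set, of a linear cost plus `ε ∑ P log P`. Strict convexity makes the plan unique, and
Danskin's theorem (`IsMinimizer.hasFDerivAt_minCost`) identifies the derivative in the linear cost
with that plan. In the self term both arguments move, but the plan is symmetric, so the variation is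
twice the one-sided one and the factor `1/2` cancels. The difference of the two one-sided variations
is `ζ_ε`. -/

namespace TopNode2vec
noncomputable section

/-! ### Persistence diagrams under perturbation of the insertion times. -/

section Persistence

variable (𝕜 : Type*) [Field 𝕜] {n : ℕ}

theorem finrank_map_mkQ_add_finrank_inf {V : Type*} [AddCommGroup V] [Module 𝕜 V]
    [FiniteDimensional 𝕜 V] (Z B : Submodule 𝕜 V) :
    Module.finrank 𝕜 (Z.map B.mkQ) + Module.finrank 𝕜 (Z ⊓ B : Submodule 𝕜 V)
      = Module.finrank 𝕜 Z := by
  have h := LinearMap.finrank_range_add_finrank_ker (B.mkQ.domRestrict Z)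
  have h2 : LinearMap.ker (B.mkQ.domRestrict Z) = B.comap Z.subtype := by
    ext v; simp [LinearMap.domRestrict_apply]
  have h3 : Module.finrank 𝕜 (B.comap Z.subtype) = Module.finrank 𝕜 (Z ⊓ B : Submodule 𝕜 V) := by
    rw [← Submodule.map_comap_subtype]
    exact (Submodule.finrank_map_subtype_eq _ _).symm
  rw [LinearMap.range_domRestrict, h2, h3] at h
  exact h

/-- The dimension of the space of `k`-cycles of `K` that are boundaries in `L`. -/
def boundingRank (k : ℕ) (K L : PreAbstractSimplicialComplex (Fin n)) : ℤ :=
  Module.finrank 𝕜 (cycles 𝕜 K k ⊓ boundaries 𝕜 L k : Submodule 𝕜 (Finset (Fin n) →₀ 𝕜))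

/-- The cycle dimension depends on `K` only, so it cancels in the alternating sum defining
`multiplicity`. -/
theorem persistentBetti_eq (k : ℕ) (K L : PreAbstractSimplicialComplex (Fin n)) :
    (persistentBetti 𝕜 k K L : ℤ) = Module.finrank 𝕜 (cycles 𝕜 K k) - boundingRank 𝕜 k K L := by
  have := finrank_map_mkQ_add_finrank_inf 𝕜 (cycles 𝕜 K k) (boundaries 𝕜 L k)
  unfold persistentBetti boundingRank
  omega

variable {K K' L L' : PreAbstractSimplicialComplex (Fin n)}

theorem chains_mono (h : K ≤ K') (k : ℕ) : chains 𝕜 K k ≤ chains 𝕜 K' k :=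
  Finsupp.supported_mono fun _ hσ => ⟨h hσ.1, hσ.2⟩

theorem cycles_mono (h : K ≤ K') (k : ℕ) : cycles 𝕜 K k ≤ cycles 𝕜 K' k :=
  inf_le_inf_right _ (chains_mono 𝕜 h k)

theorem boundaries_mono (h : K ≤ K') (k : ℕ) : boundaries 𝕜 K k ≤ boundaries 𝕜 K' k :=
  Submodule.map_mono (chains_mono 𝕜 h (k + 1))

/-- Inside `Z(K') ∩ B(L')`, the subspaces `Z(K') ∩ B(L)` and `Z(K) ∩ B(L')` meet in `Z(K) ∩ B(L)`;
the dimension formula for a sum of subspaces does the rest. -/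
theorem boundingRank_supermodular (k : ℕ) (hK : K ≤ K') (hL : L ≤ L') :
    boundingRank 𝕜 k K' L + boundingRank 𝕜 k K L'
      ≤ boundingRank 𝕜 k K' L' + boundingRank 𝕜 k K L := by
  have hZ := cycles_mono 𝕜 hK k
  have hB := boundaries_mono 𝕜 hL k
  have h := Submodule.finrank_sup_add_finrank_inf_eq
    (cycles 𝕜 K' k ⊓ boundaries 𝕜 L k) (cycles 𝕜 K k ⊓ boundaries 𝕜 L' k)
  have h1 : (cycles 𝕜 K' k ⊓ boundaries 𝕜 L k) ⊓ (cycles 𝕜 K k ⊓ boundaries 𝕜 L' k)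
      = cycles 𝕜 K k ⊓ boundaries 𝕜 L k := by
    apply le_antisymm
    · exact le_inf (inf_le_right.trans inf_le_left) (inf_le_left.trans inf_le_right)
    · exact le_inf (inf_le_inf_right _ hZ) (inf_le_inf_left _ hB)
  have h2 := Submodule.finrank_mono
    (sup_le (inf_le_inf_left _ hB) (inf_le_inf_right _ hZ) :
      (cycles 𝕜 K' k ⊓ boundaries 𝕜 L k) ⊔ (cycles 𝕜 K k ⊓ boundaries 𝕜 L' k)
        ≤ cycles 𝕜 K' k ⊓ boundaries 𝕜 L' k)
  rw [h1] at h
  unfold boundingRank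
  omega

theorem VRlt_le_VR (δ : Fin n → Fin n → ℝ) (ρ : ℝ) : VRlt δ ρ ≤ VR δ ρ :=
  fun _ hσ => ⟨hσ.1, fun u hu v hv => (hσ.2 u hu v hv).le⟩

/-- Supermodularity makes this mixed difference nonnegative, so the truncation `toNat` loses
nothing. -/
theorem multiplicity_eq (δ : Fin n → Fin n → ℝ) (k : ℕ) (b d : ℝ) :
    (multiplicity 𝕜 δ k b d : ℤ) =
      boundingRank 𝕜 k (VR δ b) (VR δ d) - boundingRank 𝕜 k (VR δ b) (VRlt δ d)
        - boundingRank 𝕜 k (VRlt δ b) (VR δ d) + boundingRank 𝕜 k (VRlt δ b) (VRlt δ d) := by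
  have h := boundingRank_supermodular 𝕜 k (VRlt_le_VR δ b) (VRlt_le_VR δ d)
  unfold multiplicity
  rw [Int.toNat_of_nonneg] <;> simp only [persistentBetti_eq] <;> linarith

/-- A multiplicity is a mixed second difference over a box of pairs of complexes. When one box is
nested in another, the strips between them contribute nonnegatively by supermodularity. -/
theorem multiplicity_le_of_le {δ δ' : Fin n → Fin n → ℝ} (k : ℕ) {b d b' d' : ℝ}
    (hb₁ : VRlt δ b ≤ VRlt δ' b') (hb₂ : VR δ' b' ≤ VR δ b)
    (hd₁ : VRlt δ d ≤ VRlt δ' d') (hd₂ : VR δ' d' ≤ VR δ d) :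
    multiplicity 𝕜 δ' k b' d' ≤ multiplicity 𝕜 δ k b d := by
  have e := multiplicity_eq 𝕜 δ k b d
  have e' := multiplicity_eq 𝕜 δ' k b' d'
  have hb := VRlt_le_VR δ' b'
  have hd := VRlt_le_VR δ' d'
  have h1 := boundingRank_supermodular 𝕜 k hb₁ hd
  have h2 := boundingRank_supermodular 𝕜 k hb₂ hd
  have hbb := (hb₁.trans hb).trans hb₂
  have h3 := boundingRank_supermodular 𝕜 k hbb hd₁
  have h4 := boundingRank_supermodular 𝕜 k hbb hd₂
  omega

theorem multiplicity_le (δ : Fin n → Fin n → ℝ) (k : ℕ) (b d : ℝ) :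
    multiplicity 𝕜 δ k b d ≤ 2 * 2 ^ n := by
  have hf (K L : PreAbstractSimplicialComplex (Fin n)) :
      persistentBetti 𝕜 k K L ≤ 2 ^ n := by
    have h1 := finrank_map_mkQ_add_finrank_inf 𝕜 (cycles 𝕜 K k) (boundaries 𝕜 L k)
    have h2 := Submodule.finrank_le (cycles 𝕜 K k)
    have h3 : Module.finrank 𝕜 (Finset (Fin n) →₀ 𝕜) = 2 ^ n := by simp
    unfold persistentBetti
    omega
  have h1 := hf (VR δ b) (VRlt δ d)
  have h2 := hf (VRlt δ b) (VR δ d)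
  unfold multiplicity
  omega

theorem criticalValues_card_le (δ : Fin n → Fin n → ℝ) : (criticalValues δ).card ≤ n * n := by
  refine Finset.card_image_le.trans ?_
  simp

/-- The bound depends on `n` only, which keeps the constants in the estimate of the extra points
uniform in the moved point. -/
theorem card_PDof_le (δ : Fin n → Fin n → ℝ) :
    (PDof 𝕜 δ).card ≤ n * ((n * n) * ((n * n) * (2 * 2 ^ n))) := by
  unfold PDof
  rw [Multiset.card_sum]
  refine (Finset.sum_le_card_nsmul _ _ ((n * n) * ((n * n) * (2 * 2 ^ n))) fun k _ => ?_).trans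
    (by simp)
  rw [Multiset.card_sum]
  refine (Finset.sum_le_card_nsmul _ _ ((n * n) * (2 * 2 ^ n)) fun b _ => ?_).trans ?_
  · rw [Multiset.card_sum]
    refine (Finset.sum_le_card_nsmul _ _ (2 * 2 ^ n) fun d _ => ?_).trans ?_
    · rw [Multiset.card_replicate]
      exact multiplicity_le 𝕜 δ k b d
    · rw [smul_eq_mul]
      gcongr
      exact (Finset.card_filter_le _ _).trans (criticalValues_card_le δ)
  · rw [smul_eq_mul]
    gcongr
    exact criticalValues_card_le δ

theorem count_PDof {δ : Fin n → Fin n → ℝ} {b d : ℝ} (hb : b ∈ criticalValues δ)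
    (hd : d ∈ criticalValues δ) (hbd : b < d) :
    (PDof 𝕜 δ).count (b, d) = ∑ k ∈ Finset.range n, multiplicity 𝕜 δ k b d := by
  unfold PDof
  rw [Multiset.count_sum']
  refine Finset.sum_congr rfl fun k _ => ?_
  rw [Multiset.count_sum', Finset.sum_eq_single_of_mem b hb, Multiset.count_sum',
    Finset.sum_eq_single_of_mem d (by simp [hd, hbd])]
  · simp
  · intro d' _ hne
    simp [Multiset.count_replicate, hne]
  · intro b' _ hne
    rw [Multiset.count_sum']
    exact Finset.sum_eq_zero fun d' _ => by simp [Multiset.count_replicate, hne]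

theorem mem_criticalValues (δ : Fin n → Fin n → ℝ) (u v : Fin n) : δ u v ∈ criticalValues δ :=
  Finset.mem_image.2 ⟨(u, v), Finset.mem_univ _, rfl⟩

/-- `δ'` respects every strict inequality between values of `δ`. -/
def Refines (δ δ' : Fin n → Fin n → ℝ) : Prop :=
  ∀ u v w z, δ u v < δ w z → δ' u v < δ' w z

variable {δ δ' : Fin n → Fin n → ℝ}

theorem Refines.eq_of_eq (h : Refines δ δ') {u v w z : Fin n} (he : δ' u v = δ' w z) :
    δ u v = δ w z := by
  rcases lt_trichotomy (δ u v) (δ w z) with hl | hl | hl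
  · exact absurd he (h _ _ _ _ hl).ne
  · exact hl
  · exact absurd he (h _ _ _ _ hl).ne'

theorem Refines.VRlt_le (h : Refines δ δ') (u v : Fin n) :
    VRlt δ (δ u v) ≤ VRlt δ' (δ' u v) :=
  fun _ hσ => ⟨hσ.1, fun a ha b hb => h _ _ _ _ (hσ.2 a ha b hb)⟩

theorem Refines.VR_le (h : Refines δ δ') (u v : Fin n) : VR δ' (δ' u v) ≤ VR δ (δ u v) :=
  fun _ hσ => ⟨hσ.1, fun a ha b hb => le_of_not_gt fun hlt =>
    (h _ _ _ _ hlt).not_ge (hσ.2 a ha b hb)⟩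

/-- The edges at which `δ` takes the value `δ u v` all have the same value for `δ'`. -/
def Tied (δ δ' : Fin n → Fin n → ℝ) (u v : Fin n) : Prop :=
  ∀ a b, δ a b = δ u v → δ' a b = δ' u v

theorem Refines.le_VRlt (h : Refines δ δ') {u v : Fin n} (ht : Tied δ δ' u v) :
    VRlt δ' (δ' u v) ≤ VRlt δ (δ u v) := fun _ hσ => ⟨hσ.1, fun a ha b hb => by
  have hlt := hσ.2 a ha b hb
  refine lt_of_le_of_ne (le_of_not_gt fun hgt => (h _ _ _ _ hgt).not_gt hlt) fun he => ?_
  exact hlt.ne (ht a b he)⟩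

theorem Refines.le_VR (h : Refines δ δ') {u v : Fin n} (ht : Tied δ δ' u v) :
    VR δ (δ u v) ≤ VR δ' (δ' u v) := fun _ hσ => ⟨hσ.1, fun a ha b hb => by
  rcases (hσ.2 a ha b hb).lt_or_eq with hl | hl
  · exact (h _ _ _ _ hl).le
  · exact (ht a b hl).le⟩

/-- Nesting of the complexes always gives `≤`. At a point of the diagram the tie hypothesis makes
the complexes coincide; elsewhere the larger side is already zero. -/
theorem Refines.count_eq (h : Refines δ δ')
    (htied : ∀ u v w z, (δ u v, δ w z) ∈ PDof 𝕜 δ → Tied δ δ' u v ∧ Tied δ δ' w z)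
    {u v w z : Fin n} (hlt : δ u v < δ w z) :
    (PDof 𝕜 δ').count (δ' u v, δ' w z) = (PDof 𝕜 δ).count (δ u v, δ w z) := by
  have e := count_PDof 𝕜 (mem_criticalValues δ u v) (mem_criticalValues δ w z) hlt
  have e' := count_PDof 𝕜 (mem_criticalValues δ' u v) (mem_criticalValues δ' w z) (h _ _ _ _ hlt)
  have hle (k : ℕ) := multiplicity_le_of_le 𝕜 k (h.VRlt_le u v) (h.VR_le u v)
    (h.VRlt_le w z) (h.VR_le w z)
  by_cases hmem : (δ u v, δ w z) ∈ PDof 𝕜 δ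
  · obtain ⟨t₁, t₂⟩ := htied _ _ _ _ hmem
    rw [e, e']
    refine Finset.sum_congr rfl fun k _ => le_antisymm (hle k) ?_
    exact multiplicity_le_of_le 𝕜 k (h.le_VRlt t₁) (h.le_VR t₁) (h.le_VRlt t₂) (h.le_VR t₂)
  · rw [Multiset.count_eq_zero_of_notMem hmem] at e ⊢
    rw [e']
    refine Finset.sum_eq_zero fun k hk => ?_
    have h0 := Finset.sum_eq_zero_iff.1 e.symm k hk
    have := hle k
    omega

theorem pts_mem (α : Multiset (ℝ × ℝ)) (x : α) : pts α x ∈ α := Multiset.coe_mem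

theorem map_pts_univ (α : Multiset (ℝ × ℝ)) : (Finset.univ : Finset α).val.map (pts α) = α :=
  Multiset.map_univ_coe α

/-- Under a perturbation refining the order of the insertion times, the points of the diagram
move along with their edges, and the remaining points come from edges that were tied. -/
theorem Refines.exists_PDof_eq_add (h : Refines δ δ')
    (htied : ∀ u v w z, (δ u v, δ w z) ∈ PDof 𝕜 δ → Tied δ δ' u v ∧ Tied δ δ' w z)
    (bE dE : PDof 𝕜 δ → Fin n × Fin n)
    (hb : ∀ x, δ (bE x).1 (bE x).2 = (pts (PDof 𝕜 δ) x).1)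
    (hd : ∀ x, δ (dE x).1 (dE x).2 = (pts (PDof 𝕜 δ) x).2) :
    ∃ R : Multiset (ℝ × ℝ),
      PDof 𝕜 δ' = (Finset.univ.val.map fun x => (δ' (bE x).1 (bE x).2, δ' (dE x).1 (dE x).2)) + R ∧
      ∀ y ∈ R, y ∈ PDof 𝕜 δ' ∧ ∃ u v w z, y = (δ' u v, δ' w z) ∧ δ u v = δ w z := by
  set S : Multiset (ℝ × ℝ) :=
    Finset.univ.val.map fun x => (δ' (bE x).1 (bE x).2, δ' (dE x).1 (dE x).2) with hS
  have hpt (x : PDof 𝕜 δ) : pts (PDof 𝕜 δ) x = (δ (bE x).1 (bE x).2, δ (dE x).1 (dE x).2) :=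
    Prod.ext (hb x).symm (hd x).symm
  have hmem (x : PDof 𝕜 δ) : (δ (bE x).1 (bE x).2, δ (dE x).1 (dE x).2) ∈ PDof 𝕜 δ :=
    hpt x ▸ pts_mem _ x
  have hcount {u v w z : Fin n} (hlt : δ u v < δ w z) :
      S.count (δ' u v, δ' w z) = (PDof 𝕜 δ).count (δ u v, δ w z) := by
    conv_rhs => rw [← map_pts_univ (PDof 𝕜 δ)]
    rw [hS, Multiset.count_map, Multiset.count_map]
    congr 1
    refine Multiset.filter_congr fun x _ => ?_
    rw [hpt x, Prod.mk.injEq, Prod.mk.injEq]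
    constructor
    · rintro ⟨h1, h2⟩
      exact ⟨h.eq_of_eq h1, h.eq_of_eq h2⟩
    · rintro ⟨h1, h2⟩
      obtain ⟨t₁, t₂⟩ := htied _ _ _ _ (hmem x)
      exact ⟨t₁ _ _ h1, t₂ _ _ h2⟩
  have hlt_of_count {y : ℝ × ℝ} (hy : S.count y ≠ (PDof 𝕜 δ').count y) :
      y ∈ PDof 𝕜 δ' ∧ ∃ u v w z, y = (δ' u v, δ' w z) ∧ δ u v = δ w z := by
    have hmem' : y ∈ PDof 𝕜 δ' := by
      by_contra hn
      rw [Multiset.count_eq_zero_of_notMem hn] at hy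
      obtain ⟨x, -, hx⟩ := Multiset.mem_map.1 (Multiset.count_ne_zero.1 hy)
      have hlt : δ (bE x).1 (bE x).2 < δ (dE x).1 (dE x).2 := (mem_PDof 𝕜 (hmem x)).2.2
      have := h.count_eq 𝕜 htied hlt
      rw [hx, Multiset.count_eq_zero_of_notMem hn] at this
      exact Multiset.count_ne_zero.2 (hmem x) this.symm
    refine ⟨hmem', ?_⟩
    obtain ⟨h1, h2, h3⟩ := mem_PDof 𝕜 hmem'
    obtain ⟨⟨u, v⟩, -, huv⟩ := Finset.mem_image.1 h1
    obtain ⟨⟨w, z⟩, -, hwz⟩ := Finset.mem_image.1 h2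
    have hyy : y = (δ' u v, δ' w z) := Prod.ext huv.symm hwz.symm
    refine ⟨u, v, w, z, hyy, ?_⟩
    rcases lt_trichotomy (δ u v) (δ w z) with hl | hl | hl
    · exact absurd (by rw [hyy, hcount hl, h.count_eq 𝕜 htied hl]) hy
    · exact hl
    · have := h _ _ _ _ hl
      rw [hyy] at h3
      exact absurd h3 this.not_gt
  -- A surplus in `S` could occur only where the birth and death edges were tied for `δ`, but the
  -- points of `S` come from points with birth strictly below death.
  have hle : S ≤ PDof 𝕜 δ' := by
    rw [Multiset.le_iff_count]
    intro y
    by_contra hn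
    obtain ⟨-, u, v, w, z, rfl, he⟩ := hlt_of_count (y := y) (by omega)
    have : (δ' u v, δ' w z) ∈ S := Multiset.count_pos.1 (by omega)
    obtain ⟨x, -, hx⟩ := Multiset.mem_map.1 this
    rw [Prod.mk.injEq] at hx
    have hlt : δ (bE x).1 (bE x).2 < δ (dE x).1 (dE x).2 := (mem_PDof 𝕜 (hmem x)).2.2
    rw [h.eq_of_eq hx.1, h.eq_of_eq hx.2, he] at hlt
    exact lt_irrefl _ hlt
  refine ⟨PDof 𝕜 δ' - S, (add_tsub_cancel_of_le hle).symm, fun y hy => hlt_of_count ?_⟩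
  have := Multiset.count_pos.2 hy
  rw [Multiset.count_sub] at this
  omega

theorem boundary_single (σ : Finset (Fin n)) :
    boundary 𝕜 (Finsupp.single σ 1) =
      if 2 ≤ σ.card then
        ∑ v ∈ σ, Finsupp.single (σ.erase v) ((-1 : 𝕜) ^ (σ.filter (fun w => w < v)).card)
      else 0 := by
  simp [boundary]

/-- A shortest edge yields the point `(0, δ u v)` in degree zero: its boundary is a cycle of
vertices from time `0` on, and nothing bounds before the first edge enters. Nonemptiness matters
because total persistence appears in logarithms and denominators. -/
theorem PDof_ne_zero (hn : 2 ≤ n) (hself : ∀ u, δ u u = 0) (hpos : ∀ u v, u ≠ v → 0 < δ u v)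
    (hsymm : ∀ u v, δ u v = δ v u) : PDof 𝕜 δ ≠ 0 := by
  obtain ⟨⟨u, v⟩, he, hmin⟩ := Finset.exists_min_image
    ((Finset.univ : Finset (Fin n × Fin n)).filter fun e => e.1 ≠ e.2) (fun e => δ e.1 e.2)
    ⟨(⟨0, by omega⟩, ⟨1, by omega⟩), by simp⟩
  simp only [Finset.mem_filter, Finset.mem_univ, true_and, ne_eq, Prod.forall] at he hmin
  have hd : 0 < δ u v := hpos u v he
  have hc0 : (0 : ℝ) ∈ criticalValues δ := hself u ▸ mem_criticalValues δ u u
  have hmul : 0 < multiplicity 𝕜 δ 0 0 (δ u v) := by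
    have h1 (L : PreAbstractSimplicialComplex (Fin n)) :
        boundingRank 𝕜 0 (VRlt δ 0) L = 0 := by
      have hbot : cycles 𝕜 (VRlt δ 0) 0 = ⊥ := by
        have : {σ : Finset (Fin n) | σ ∈ VRlt δ 0 ∧ σ.card = 0 + 1} = ∅ := by
          refine Set.eq_empty_of_forall_notMem fun σ hσ => ?_
          obtain ⟨w, hw⟩ := hσ.1.1
          exact (hσ.1.2 w hw w hw).ne (hself w)
        rw [cycles, chains, this, Finsupp.supported_empty, bot_inf_eq]
      rw [boundingRank, hbot, bot_inf_eq, finrank_bot, Nat.cast_zero]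
    have h2 : boundingRank 𝕜 0 (VR δ 0) (VRlt δ (δ u v)) = 0 := by
      have hbot : boundaries 𝕜 (VRlt δ (δ u v)) 0 = ⊥ := by
        have : {σ : Finset (Fin n) | σ ∈ VRlt δ (δ u v) ∧ σ.card = 0 + 1 + 1} = ∅ := by
          refine Set.eq_empty_of_forall_notMem fun σ hσ => ?_
          obtain ⟨a, b, hab, rfl⟩ := Finset.card_eq_two.1 hσ.2
          exact (hσ.1.2 a (by simp) b (by simp)).not_ge (hmin a b hab)
        rw [boundaries, chains, this, Finsupp.supported_empty, Submodule.map_bot]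
      rw [boundingRank, hbot, inf_bot_eq, finrank_bot, Nat.cast_zero]
    have h3 : 0 < boundingRank 𝕜 0 (VR δ 0) (VR δ (δ u v)) := by
      have hmem : boundary 𝕜 (Finsupp.single {u, v} 1) ∈
          cycles 𝕜 (VR δ 0) 0 ⊓ boundaries 𝕜 (VR δ (δ u v)) 0 := by
        have hvert (w : Fin n) (c : 𝕜) : Finsupp.single {w} c ∈ cycles 𝕜 (VR δ 0) 0 := by
          refine ⟨Finsupp.single_mem_supported 𝕜 _ ⟨⟨by simp, ?_⟩, by simp⟩, ?_⟩
          · simp [hself]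
          · simp [boundary]
        refine ⟨?_, Submodule.mem_map_of_mem
          (Finsupp.single_mem_supported 𝕜 _ ⟨⟨by simp, ?_⟩, Finset.card_pair he⟩)⟩
        · rw [boundary_single, if_pos (Finset.card_pair he).ge, Finset.sum_pair he,
            Finset.erase_insert (by simpa using he), Finset.pair_comm,
            Finset.erase_insert (by simpa using Ne.symm he)]
          exact add_mem (hvert _ _) (hvert _ _)
        · simp [hself, hd.le, hsymm v u]
      have hne : boundary 𝕜 (Finsupp.single ({u, v} : Finset (Fin n)) (1 : 𝕜)) ≠ 0 := by
        rw [boundary_single, if_pos (Finset.card_pair he).ge, Finset.sum_pair he,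
            Finset.erase_insert (by simpa using he), Finset.pair_comm,
            Finset.erase_insert (by simpa using Ne.symm he)]
        intro h0
        have := DFunLike.congr_fun h0 {v}
        simp [he] at this
      unfold boundingRank
      have := Submodule.one_le_finrank_iff.2 (Submodule.ne_bot_iff _ |>.2 ⟨_, hmem, hne⟩)
      omega
    have := multiplicity_eq 𝕜 δ 0 0 (δ u v)
    rw [h1, h1, h2] at this
    omega
  have hcount := count_PDof 𝕜 hc0 (mem_criticalValues δ u v) hd
  have : 0 < (PDof 𝕜 δ).count (0, δ u v) := by
    rw [hcount]
    exact hmul.trans_le (Finset.single_le_sum (f := fun k => multiplicity 𝕜 δ k 0 (δ u v))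
      (fun _ _ => Nat.zero_le _) (Finset.mem_range.2 (by omega)))
  intro h0
  simp [h0] at this

theorem PDof_eq_zero (hn : n < 2) : PDof 𝕜 δ = 0 := by
  refine Multiset.eq_zero_of_forall_notMem fun x hx => ?_
  obtain ⟨h1, h2, h3⟩ := mem_PDof 𝕜 hx
  obtain ⟨e, -, he⟩ := Finset.mem_image.1 h1
  obtain ⟨f, -, hf⟩ := Finset.mem_image.1 h2
  have : Subsingleton (Fin n) := Fin.subsingleton_iff_le_one.2 (by omega)
  rw [← he, ← hf, Subsingleton.elim e f] at h3
  exact lt_irrefl _ h3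

end Persistence

/-! ### The regularized problem as an entropic linear program. -/

section Transport

variable {ι κ : Type*} [Fintype ι] [Fintype κ]

theorem sqDist_projDiag (x : ℝ × ℝ) : sqDist x (projDiag x) = (x.2 - x.1) ^ 2 / 2 := by
  simp only [sqDist, projDiag]; ring

theorem sqDist_projDiag_pos {x : ℝ × ℝ} (hx : x ∈ Omega) : 0 < sqDist x (projDiag x) := by
  have : 0 < x.2 - x.1 := sub_pos.2 hx
  rw [sqDist_projDiag]; positivity

theorem sqDist_projDiag_nonneg (x : ℝ × ℝ) : 0 ≤ sqDist x (projDiag x) := by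
  rw [sqDist_projDiag]; positivity

theorem pers_nonneg (x : ι → ℝ × ℝ) : 0 ≤ pers x :=
  Finset.sum_nonneg fun i _ => sqDist_projDiag_nonneg (x i)

theorem pers_pos [Nonempty ι] {x : ι → ℝ × ℝ} (hx : ∀ i, x i ∈ Omega) : 0 < pers x :=
  Finset.sum_pos (fun i _ => sqDist_projDiag_pos (hx i)) Finset.univ_nonempty

/-- A linear cost plus `ε` times the negative entropy. -/
def entropicCost (ε : ℝ) (c : ι → κ → ℝ) (P : Matrix ι κ ℝ) : ℝ :=
  ∑ i, ∑ j, (c i j * P i j + ε * (P i j * Real.log (P i j)))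

theorem isCompact_partialPlans : IsCompact (partialPlans ι κ) := by
  refine IsCompact.of_isClosed_subset
    (isCompact_univ_pi fun _ : ι => isCompact_univ_pi fun _ : κ => isCompact_Icc (a := (0:ℝ)) (b := 1))
    ?_ ?_
  · simp only [partialPlans, Set.ofPred_and, Set.ofPred_forall]
    refine IsClosed.inter ?_ (IsClosed.inter ?_ ?_)
    · exact isClosed_iInter fun i => isClosed_iInter fun j =>
        isClosed_le (by fun_prop) (by fun_prop)
    · exact isClosed_iInter fun j => isClosed_le (by fun_prop) (by fun_prop)
    · exact isClosed_iInter fun i => isClosed_le (by fun_prop) (by fun_prop)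
  · rintro P ⟨h0, -, h2⟩ i - j -
    exact ⟨h0 i j, (Finset.single_le_sum (fun j _ => h0 i j) (Finset.mem_univ j)).trans (h2 i)⟩

theorem zero_mem_partialPlans : (0 : Matrix ι κ ℝ) ∈ partialPlans ι κ := by
  simp [partialPlans]

theorem convex_partialPlans {P Q : Matrix ι κ ℝ} (hP : P ∈ partialPlans ι κ)
    (hQ : Q ∈ partialPlans ι κ) : (1 / 2 : ℝ) • P + (1 / 2 : ℝ) • Q ∈ partialPlans ι κ := by
  refine ⟨fun i j => ?_, fun j => ?_, fun i => ?_⟩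
  · have := hP.1 i j
    have := hQ.1 i j
    simp only [Matrix.add_apply, Matrix.smul_apply, smul_eq_mul]
    positivity
  · simp only [Matrix.add_apply, Matrix.smul_apply, smul_eq_mul, Finset.sum_add_distrib,
      ← Finset.mul_sum]
    linarith [hP.2.1 j, hQ.2.1 j]
  · simp only [Matrix.add_apply, Matrix.smul_apply, smul_eq_mul, Finset.sum_add_distrib,
      ← Finset.mul_sum]
    linarith [hP.2.2 i, hQ.2.2 i]

theorem continuous_entropicCost (ε : ℝ) (c : ι → κ → ℝ) : Continuous (entropicCost ε c) := by
  unfold entropicCost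
  refine continuous_finsetSum _ fun i _ => continuous_finsetSum _ fun j _ => ?_
  have hij : Continuous fun P : Matrix ι κ ℝ => P i j := by fun_prop
  exact (continuous_const.mul hij).add
    (continuous_const.mul (Real.continuous_mul_log.comp hij))

/-- `P` minimizes the entropic cost over the partial plans. -/
def IsMinimizer (ε : ℝ) (c : ι → κ → ℝ) (P : Matrix ι κ ℝ) : Prop :=
  P ∈ partialPlans ι κ ∧ ∀ Q ∈ partialPlans ι κ, entropicCost ε c P ≤ entropicCost ε c Q

theorem exists_isMinimizer (ε : ℝ) (c : ι → κ → ℝ) : ∃ P, IsMinimizer ε c P := by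
  obtain ⟨P, hP, hmin⟩ := isCompact_partialPlans.exists_isMinOn
    ⟨0, zero_mem_partialPlans (ι := ι) (κ := κ)⟩ (continuous_entropicCost ε c).continuousOn
  exact ⟨P, hP, fun Q hQ => hmin hQ⟩

theorem two_mul_mid_mul_log_le {s t : ℝ} (hs : 0 ≤ s) (ht : 0 ≤ t) :
    2 * ((1 / 2 * s + 1 / 2 * t) * Real.log (1 / 2 * s + 1 / 2 * t))
      ≤ s * Real.log s + t * Real.log t := by
  have := Real.convexOn_mul_log.2 hs ht (half_pos (zero_lt_one' ℝ)).le
    (half_pos (zero_lt_one' ℝ)).le (add_halves 1)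
  simp only [smul_eq_mul] at this
  linarith

theorem two_mul_mid_mul_log_lt {s t : ℝ} (hs : 0 ≤ s) (ht : 0 ≤ t) (hst : s ≠ t) :
    2 * ((1 / 2 * s + 1 / 2 * t) * Real.log (1 / 2 * s + 1 / 2 * t))
      < s * Real.log s + t * Real.log t := by
  have := Real.strictConvexOn_mul_log.2 hs ht hst (half_pos (zero_lt_one' ℝ))
    (half_pos (zero_lt_one' ℝ)) (add_halves 1)
  simp only [smul_eq_mul] at this
  linarith

theorem IsMinimizer.unique {ε : ℝ} (hε : 0 < ε) {c : ι → κ → ℝ} {P Q : Matrix ι κ ℝ}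
    (hP : IsMinimizer ε c P) (hQ : IsMinimizer ε c Q) : P = Q := by
  by_contra hne
  obtain ⟨i₀, j₀, hij⟩ : ∃ i j, P i j ≠ Q i j := by
    by_contra! h
    exact hne (Matrix.ext h)
  have hmid := hP.2 _ (convex_partialPlans hP.1 hQ.1)
  have hPQ := hP.2 _ hQ.1
  have hQP := hQ.2 _ hP.1
  have hlt : 2 * entropicCost ε c ((1 / 2 : ℝ) • P + (1 / 2 : ℝ) • Q)
      < entropicCost ε c P + entropicCost ε c Q := by
    unfold entropicCost
    simp only [Finset.mul_sum, ← Finset.sum_add_distrib]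
    simp only [Matrix.add_apply, Matrix.smul_apply, smul_eq_mul]
    have hle (i : ι) (j : κ) := two_mul_mid_mul_log_le (hP.1.1 i j) (hQ.1.1 i j)
    refine Finset.sum_lt_sum (fun i _ => Finset.sum_le_sum fun j _ => ?_)
      ⟨i₀, Finset.mem_univ _, Finset.sum_lt_sum (fun j _ => ?_) ⟨j₀, Finset.mem_univ _, ?_⟩⟩
    · linear_combination mul_le_mul_of_nonneg_left (hle i j) hε.le
    · linear_combination mul_le_mul_of_nonneg_left (hle i₀ j) hε.le
    · linear_combination mul_lt_mul_of_pos_left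
        (two_mul_mid_mul_log_lt (hP.1.1 i₀ j₀) (hQ.1.1 i₀ j₀) hij) hε
  linarith

/-- The minimal entropic cost. -/
def minCost (ε : ℝ) (c : ι → κ → ℝ) : ℝ := sInf (entropicCost ε c '' partialPlans ι κ)

theorem IsMinimizer.minCost_eq {ε : ℝ} {c : ι → κ → ℝ} {P : Matrix ι κ ℝ}
    (hP : IsMinimizer ε c P) : minCost ε c = entropicCost ε c P :=
  IsLeast.csInf_eq ⟨⟨P, hP.1, rfl⟩, by rintro _ ⟨Q, hQ, rfl⟩; exact hP.2 Q hQ⟩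

theorem minCost_le (ε : ℝ) (c : ι → κ → ℝ) {P : Matrix ι κ ℝ} (hP : P ∈ partialPlans ι κ) :
    minCost ε c ≤ entropicCost ε c P := by
  obtain ⟨Q, hQ⟩ := exists_isMinimizer ε c
  exact hQ.minCost_eq.trans_le (hQ.2 P hP)

theorem entropicCost_sub (ε : ℝ) (c c' : ι → κ → ℝ) (P : Matrix ι κ ℝ) :
    entropicCost ε c P - entropicCost ε c' P = ∑ i, ∑ j, (c i j - c' i j) * P i j := by
  unfold entropicCost
  simp only [← Finset.sum_sub_distrib]
  exact Finset.sum_congr rfl fun i _ => Finset.sum_congr rfl fun j _ => by ring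

theorem partialPlans_le_one {P : Matrix ι κ ℝ} (hP : P ∈ partialPlans ι κ) (i : ι) (j : κ) :
    P i j ≤ 1 :=
  (Finset.single_le_sum (fun j _ => hP.1 i j) (Finset.mem_univ j)).trans (hP.2.2 i)

theorem abs_sum_mul_le (c : ι → κ → ℝ) (M : Matrix ι κ ℝ) {s : ℝ} (hM : ∀ i j, |M i j| ≤ s) :
    |∑ i, ∑ j, c i j * M i j| ≤ (Fintype.card ι * Fintype.card κ) * (‖c‖ * s) := by
  have hc (i : ι) (j : κ) : |c i j| ≤ ‖c‖ := (norm_le_pi_norm (c i) j).trans (norm_le_pi_norm c i)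
  calc |∑ i, ∑ j, c i j * M i j| ≤ ∑ i : ι, ∑ j : κ, ‖c‖ * s := by
        refine (Finset.abs_sum_le_sum_abs _ _).trans (Finset.sum_le_sum fun i _ => ?_)
        refine (Finset.abs_sum_le_sum_abs _ _).trans (Finset.sum_le_sum fun j _ => ?_)
        rw [abs_mul]
        exact mul_le_mul (hc i j) (hM i j) (abs_nonneg _) (norm_nonneg _)
    _ = _ := by simp; ring

theorem abs_entropicCost_sub_le (ε : ℝ) (c c' : ι → κ → ℝ) {P : Matrix ι κ ℝ}
    (hP : P ∈ partialPlans ι κ) :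
    |entropicCost ε c P - entropicCost ε c' P| ≤
      (Fintype.card ι * Fintype.card κ) * ‖c - c'‖ := by
  rw [entropicCost_sub]
  have := abs_sum_mul_le (c - c') P (s := 1)
    fun i j => by rw [abs_of_nonneg (hP.1 i j)]; exact partialPlans_le_one hP i j
  simpa using this

/-- The minimizers are continuous in the cost. -/
theorem IsMinimizer.eventually_close {ε : ℝ} (hε : 0 < ε) {c₀ : ι → κ → ℝ} {P₀ : Matrix ι κ ℝ}
    (h₀ : IsMinimizer ε c₀ P₀) {s : ℝ} (hs : 0 < s) :
    ∀ᶠ c in nhds c₀, ∀ P, IsMinimizer ε c P → ∀ i j, |P i j - P₀ i j| ≤ s := by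
  set U : Set (Matrix ι κ ℝ) := {P | ∀ i j, |P i j - P₀ i j| < s} with hU
  have hUo : IsOpen U := by
    simp only [hU, Set.ofPred_forall]
    exact isOpen_iInter_of_finite fun i => isOpen_iInter_of_finite fun j =>
      isOpen_lt (by fun_prop) (by fun_prop)
  have hK : IsCompact (partialPlans ι κ \ U) := isCompact_partialPlans.diff hUo
  -- By compactness and uniqueness, plans outside `U` exceed the optimum by a fixed gap `g`.
  -- Changing the cost alters the values at `P` and at `P₀` by at most `A * ‖c - c₀‖` each, too
  -- little to close the gap.
  obtain ⟨g, hg, hgap⟩ : ∃ g > 0, ∀ P ∈ partialPlans ι κ \ U,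
      entropicCost ε c₀ P₀ + g ≤ entropicCost ε c₀ P := by
    rcases (partialPlans ι κ \ U).eq_empty_or_nonempty with he | hne
    · exact ⟨1, one_pos, by simp [he]⟩
    · obtain ⟨Q, hQ, hmin⟩ := hK.exists_isMinOn hne (continuous_entropicCost ε c₀).continuousOn
      have hlt : entropicCost ε c₀ P₀ < entropicCost ε c₀ Q := by
        refine lt_of_le_of_ne (h₀.2 Q hQ.1) fun he => hQ.2 ?_
        have : Q = P₀ := IsMinimizer.unique hε ⟨hQ.1, fun R hR => he ▸ h₀.2 R hR⟩ h₀
        simp [hU, this, hs]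
      exact ⟨_, sub_pos.2 hlt, fun P hP => by linarith [isMinOn_iff.1 hmin P hP]⟩
  set A : ℝ := Fintype.card ι * Fintype.card κ
  have hev : ∀ᶠ c in nhds c₀, 2 * (A * ‖c - c₀‖) < g := by
    have : Filter.Tendsto (fun c : ι → κ → ℝ => 2 * (A * ‖c - c₀‖)) (nhds c₀) (nhds 0) := by
      have h : Continuous fun c : ι → κ → ℝ => 2 * (A * ‖c - c₀‖) := by fun_prop
      simpa using h.tendsto c₀
    exact this.eventually (gt_mem_nhds hg)
  filter_upwards [hev] with c hc P hP
  by_contra hfar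
  have hPU : P ∈ partialPlans ι κ \ U :=
    ⟨hP.1, fun hin => hfar fun i j => (hin i j).le⟩
  have h1 := abs_le.1 (abs_entropicCost_sub_le ε c c₀ hP.1)
  have h2 := abs_le.1 (abs_entropicCost_sub_le ε c c₀ h₀.1)
  have h3 := hP.2 _ h₀.1
  have h4 := hgap P hPU
  linarith [h1.1, h2.2]

/-- Danskin's theorem for the minimal entropic cost. -/
theorem IsMinimizer.hasFDerivAt_minCost {ε : ℝ} (hε : 0 < ε) {c₀ : ι → κ → ℝ}
    {P₀ : Matrix ι κ ℝ} (h₀ : IsMinimizer ε c₀ P₀) :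
    HasFDerivAt (minCost ε : (ι → κ → ℝ) → ℝ)
      (∑ i, ∑ j, P₀ i j • (ContinuousLinearMap.proj j ∘L ContinuousLinearMap.proj i :
        (ι → κ → ℝ) →L[ℝ] ℝ)) c₀ := by
  rw [hasFDerivAt_iff_isLittleO, Asymptotics.isLittleO_iff]
  intro r hr
  set A : ℝ := Fintype.card ι * Fintype.card κ
  have hA : 0 ≤ A := by positivity
  have hs : 0 < r / (A + 1) := by positivity
  filter_upwards [h₀.eventually_close hε hs] with c hc
  obtain ⟨P, hP⟩ := exists_isMinimizer ε c
  have hl : (∑ i, ∑ j, P₀ i j • (ContinuousLinearMap.proj j ∘L ContinuousLinearMap.proj i :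
        (ι → κ → ℝ) →L[ℝ] ℝ)) (c - c₀) = entropicCost ε c P₀ - entropicCost ε c₀ P₀ := by
    rw [entropicCost_sub]
    simp [mul_comm]
  rw [hl, hP.minCost_eq, h₀.minCost_eq]
  -- Optimality of `P` for `c` and of `P₀` for `c₀` places the first-order error between `∑ (c -
  -- c₀)(P - P₀)` and `0`.
  have h1 := hP.2 _ h₀.1
  have h2 := h₀.2 _ hP.1
  have h3 : (entropicCost ε c P - entropicCost ε c₀ P) - (entropicCost ε c P₀ - entropicCost ε c₀ P₀)
      = ∑ i, ∑ j, (c - c₀) i j * (P - P₀) i j := by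
    rw [entropicCost_sub, entropicCost_sub]
    simp only [← Finset.sum_sub_distrib]
    exact Finset.sum_congr rfl fun i _ => Finset.sum_congr rfl fun j _ => by
      simp only [Pi.sub_apply, Matrix.sub_apply]; ring
  have h4 := abs_le.1 (abs_sum_mul_le (c - c₀) (P - P₀) (hc P hP))
  rw [← h3] at h4
  have h5 : A * (‖c - c₀‖ * (r / (A + 1))) ≤ r * ‖c - c₀‖ := by
    have : A / (A + 1) ≤ 1 := (div_le_one (by positivity)).2 (by linarith)
    calc A * (‖c - c₀‖ * (r / (A + 1))) = (A / (A + 1)) * (r * ‖c - c₀‖) := by ring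
      _ ≤ 1 * (r * ‖c - c₀‖) := by gcongr
      _ = _ := one_mul _
  rw [Real.norm_eq_abs, abs_le]
  constructor <;> linarith [h4.1, h4.2]

/-- The linear part of the regularized cost, once the entropic terms are expanded. -/
def effCost (ε : ℝ) (x : ι → ℝ × ℝ) (y : κ → ℝ × ℝ) (i : ι) (j : κ) : ℝ :=
  sqDist (x i) (y j) - sqDist (x i) (projDiag (x i)) - sqDist (y j) (projDiag (y j))
    - ε * (Real.log (sqDist (x i) (projDiag (x i))) + Real.log (sqDist (y j) (projDiag (y j))))
    + ε / 2 * (Real.log (pers x) + Real.log (pers y)) - ε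

/-- The reference matrix normalized by `pers x` has total mass `pers y`, and conversely; this
produces the constant with `ε / 2`. All weights are positive, so the logarithms split into a part
linear in `P` and the entropy, leaving a feasible set independent of the points. -/
theorem objective_eq (ε : ℝ) {x : ι → ℝ × ℝ} {y : κ → ℝ × ℝ} (hx : ∀ i, x i ∈ Omega)
    (hy : ∀ j, y j ∈ Omega) [Nonempty ι] [Nonempty κ] (P : Matrix ι κ ℝ) :
    objective ε x y P = (1 + ε / 2) * (pers x + pers y) + entropicCost ε (effCost ε x y) P := by
  have hpx := pers_pos hx
  have hpy := pers_pos hy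
  have hKL (c : ℝ) (hc : 0 < c) : KL P (refMatrix x y c) =
      ∑ i, ∑ j, (P i j * Real.log (P i j) - P i j
        * (Real.log (sqDist (x i) (projDiag (x i))) + Real.log (sqDist (y j) (projDiag (y j)))
          - Real.log c + 1)) + pers x * pers y / c := by
    unfold KL
    have hB : pers x * pers y / c = ∑ i, ∑ j, refMatrix x y c i j := by
      simp only [pers, refMatrix, Finset.sum_mul_sum, Finset.sum_div]
    rw [hB]
    simp only [← Finset.sum_add_distrib]
    refine Finset.sum_congr rfl fun i _ => Finset.sum_congr rfl fun j _ => ?_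
    have ha := sqDist_projDiag_pos (hx i)
    have hb := sqDist_projDiag_pos (hy j)
    rcases eq_or_ne (P i j) 0 with h0 | h0
    · simp [h0]
    · rw [Real.log_div h0 (by unfold refMatrix; positivity)]
      conv_lhs => enter [1, 1, 2, 2]; unfold refMatrix
      rw [Real.log_div (by positivity) hc.ne', Real.log_mul ha.ne' hb.ne']
      ring
  unfold objective entropicTerm
  rw [hKL _ hpx, hKL _ hpy, mul_div_cancel_left₀ _ hpx.ne', mul_div_cancel_right₀ _ hpy.ne']
  have h1 : ∑ i, sqDist (x i) (projDiag (x i)) * (1 - ∑ j, P i j)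
      = pers x - ∑ i, ∑ j, sqDist (x i) (projDiag (x i)) * P i j := by
    simp only [mul_sub, mul_one, Finset.sum_sub_distrib, Finset.mul_sum, pers]
  have h2 : ∑ j, sqDist (y j) (projDiag (y j)) * (1 - ∑ i, P i j)
      = pers y - ∑ i, ∑ j, sqDist (y j) (projDiag (y j)) * P i j := by
    rw [Finset.sum_comm (s := (Finset.univ : Finset ι))]
    simp only [mul_sub, mul_one, Finset.sum_sub_distrib, Finset.mul_sum, pers]
  rw [h1, h2]
  have h3 : entropicCost ε (effCost ε x y) P =
      ∑ i, ∑ j, sqDist (x i) (y j) * P i j - ∑ i, ∑ j, sqDist (x i) (projDiag (x i)) * P i j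
      - ∑ i, ∑ j, sqDist (y j) (projDiag (y j)) * P i j
      + ε / 2 * ∑ i, ∑ j, (P i j * Real.log (P i j) - P i j
        * (Real.log (sqDist (x i) (projDiag (x i))) + Real.log (sqDist (y j) (projDiag (y j)))
          - Real.log (pers x) + 1))
      + ε / 2 * ∑ i, ∑ j, (P i j * Real.log (P i j) - P i j
        * (Real.log (sqDist (x i) (projDiag (x i))) + Real.log (sqDist (y j) (projDiag (y j)))
          - Real.log (pers y) + 1)) := by
    unfold entropicCost effCost
    simp only [Finset.mul_sum, ← Finset.sum_add_distrib, ← Finset.sum_sub_distrib]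
    exact Finset.sum_congr rfl fun i _ => Finset.sum_congr rfl fun j _ => by ring
  rw [h3]
  ring

theorem isOptimalPlan_iff (ε : ℝ) {x : ι → ℝ × ℝ} {y : κ → ℝ × ℝ} (hx : ∀ i, x i ∈ Omega)
    (hy : ∀ j, y j ∈ Omega) [Nonempty ι] [Nonempty κ] (P : Matrix ι κ ℝ) :
    IsOptimalPlan ε x y P ↔ IsMinimizer ε (effCost ε x y) P := by
  simp only [IsOptimalPlan, IsMinimizer, objective_eq ε hx hy, add_le_add_iff_left]

theorem existsUnique_isOptimalPlan {ε : ℝ} (hε : 0 < ε) {x : ι → ℝ × ℝ} {y : κ → ℝ × ℝ}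
    (hx : ∀ i, x i ∈ Omega) (hy : ∀ j, y j ∈ Omega) : ∃! P, IsOptimalPlan ε x y P := by
  rcases isEmpty_or_nonempty ι with hι | hι
  · exact ⟨0, ⟨zero_mem_partialPlans, fun Q _ => by rw [Subsingleton.elim Q 0]⟩,
      fun Q _ => Subsingleton.elim _ _⟩
  rcases isEmpty_or_nonempty κ with hκ | hκ
  · exact ⟨0, ⟨zero_mem_partialPlans, fun Q _ => by rw [Subsingleton.elim Q 0]⟩,
      fun Q _ => Subsingleton.elim _ _⟩
  simp only [isOptimalPlan_iff ε hx hy]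
  obtain ⟨P, hP⟩ := exists_isMinimizer ε (effCost ε x y)
  exact ⟨P, hP, fun Q hQ => hQ.unique hε hP⟩

theorem isMinimizer_optimalPlan {ε : ℝ} (hε : 0 < ε) {x : ι → ℝ × ℝ} {y : κ → ℝ × ℝ}
    (hx : ∀ i, x i ∈ Omega) (hy : ∀ j, y j ∈ Omega) [Nonempty ι] [Nonempty κ] :
    IsMinimizer ε (effCost ε x y) (optimalPlan ε x y) :=
  (isOptimalPlan_iff ε hx hy _).1
    (Classical.epsilon_spec (existsUnique_isOptimalPlan hε hx hy).exists)

theorem FGfam_eq (ε : ℝ) {x : ι → ℝ × ℝ} {y : κ → ℝ × ℝ} (hx : ∀ i, x i ∈ Omega)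
    (hy : ∀ j, y j ∈ Omega) [Nonempty ι] [Nonempty κ] :
    FGfam ε x y = (1 + ε / 2) * (pers x + pers y) + minCost ε (effCost ε x y) := by
  obtain ⟨P, hP⟩ := exists_isMinimizer ε (effCost ε x y)
  rw [hP.minCost_eq, ← objective_eq ε hx hy]
  have := (isOptimalPlan_iff ε hx hy P).2 hP
  exact IsLeast.csInf_eq ⟨⟨P, this.1, rfl⟩, by rintro _ ⟨Q, hQ, rfl⟩; exact this.2 Q hQ⟩

theorem sqDist_comm (x y : ℝ × ℝ) : sqDist x y = sqDist y x := by
  simp only [sqDist]; ring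

theorem effCost_comm (ε : ℝ) (x : ι → ℝ × ℝ) (y : κ → ℝ × ℝ) (i : ι) (j : κ) :
    effCost ε x y i j = effCost ε y x j i := by
  simp only [effCost, sqDist_comm (x i)]; ring

theorem transpose_mem_partialPlans {P : Matrix ι κ ℝ} (hP : P ∈ partialPlans ι κ) :
    P.transpose ∈ partialPlans κ ι := ⟨fun i j => hP.1 j i, hP.2.2, hP.2.1⟩

theorem entropicCost_transpose (ε : ℝ) (x : ι → ℝ × ℝ) (y : κ → ℝ × ℝ) (P : Matrix ι κ ℝ) :
    entropicCost ε (effCost ε y x) P.transpose = entropicCost ε (effCost ε x y) P := by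
  unfold entropicCost
  rw [Finset.sum_comm]
  simp only [effCost_comm ε x y, Matrix.transpose_apply]

theorem IsMinimizer.transpose {ε : ℝ} {x : ι → ℝ × ℝ} {y : κ → ℝ × ℝ} {P : Matrix ι κ ℝ}
    (hP : IsMinimizer ε (effCost ε x y) P) : IsMinimizer ε (effCost ε y x) P.transpose :=
  ⟨transpose_mem_partialPlans hP.1, fun Q hQ => by
    have := hP.2 _ (transpose_mem_partialPlans hQ)
    rwa [entropicCost_transpose, ← Matrix.transpose_transpose Q, entropicCost_transpose]⟩

theorem minCost_comm (ε : ℝ) (x : ι → ℝ × ℝ) (y : κ → ℝ × ℝ) :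
    minCost ε (effCost ε x y) = minCost ε (effCost ε y x) := by
  obtain ⟨P, hP⟩ := exists_isMinimizer ε (effCost ε x y)
  rw [hP.minCost_eq, hP.transpose.minCost_eq, entropicCost_transpose]

theorem FGfam_comm (ε : ℝ) {x : ι → ℝ × ℝ} {y : κ → ℝ × ℝ} (hx : ∀ i, x i ∈ Omega)
    (hy : ∀ j, y j ∈ Omega) [Nonempty ι] [Nonempty κ] : FGfam ε x y = FGfam ε y x := by
  rw [FGfam_eq ε hx hy, FGfam_eq ε hy hx, minCost_comm, add_comm (pers x)]

/-- The transpose is also a minimizer, and minimizers are unique. -/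
theorem optimalPlan_symm {ε : ℝ} (hε : 0 < ε) {x : ι → ℝ × ℝ} (hx : ∀ i, x i ∈ Omega)
    [Nonempty ι] (i j : ι) : optimalPlan ε x x i j = optimalPlan ε x x j i := by
  have h := isMinimizer_optimalPlan hε hx hx
  exact congrFun (congrFun (h.unique hε h.transpose) i) j

theorem FGfam_reindex {ι' κ' : Type*} [Fintype ι'] [Fintype κ'] (ε : ℝ) (e : ι ≃ ι') (f : κ ≃ κ')
    (x : ι' → ℝ × ℝ) (y : κ' → ℝ × ℝ) : FGfam ε (x ∘ e) (y ∘ f) = FGfam ε x y := by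
  have hpx : pers (x ∘ e) = pers x := Equiv.sum_comp e fun i => sqDist (x i) (projDiag (x i))
  have hpy : pers (y ∘ f) = pers y := Equiv.sum_comp f fun i => sqDist (y i) (projDiag (y i))
  have hobj (P : Matrix ι κ ℝ) :
      objective ε (x ∘ e) (y ∘ f) P = objective ε x y (P.submatrix e.symm f.symm) := by
    unfold objective entropicTerm KL
    rw [hpx, hpy]
    simp only [← Equiv.sum_comp e, ← Equiv.sum_comp f, Matrix.submatrix_apply,
      Equiv.symm_apply_apply, refMatrix, Function.comp_apply]
  have hmem (P : Matrix ι κ ℝ) :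
      P.submatrix e.symm f.symm ∈ partialPlans ι' κ' ↔ P ∈ partialPlans ι κ := by
    simp only [partialPlans, Set.mem_ofPred_eq, ← Equiv.sum_comp e, ← Equiv.sum_comp f,
      Matrix.submatrix_apply, Equiv.symm_apply_apply, ← e.forall_congr_right,
      ← f.forall_congr_right]
  unfold FGfam
  congr 1
  ext t
  constructor
  · rintro ⟨P, hP, rfl⟩
    exact ⟨_, (hmem P).2 hP, (hobj P).symm⟩
  · rintro ⟨P, hP, rfl⟩
    refine ⟨P.submatrix e f, (hmem _).1 (by simpa using hP), ?_⟩
    rw [hobj]; simp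

end Transport

/-! ### Stability of the cost under adding points. -/

section Perturbation

variable {ι κ ρ : Type*} [Fintype ι] [Fintype κ] [Fintype ρ]

theorem pers_sumElim (x : ι → ℝ × ℝ) (r : ρ → ℝ × ℝ) :
    pers (Sum.elim x r) = pers x + pers r := by
  simp [pers, Fintype.sum_sum_type]

theorem sqDist_projDiag_le_pers (x : ι → ℝ × ℝ) (i : ι) :
    sqDist (x i) (projDiag (x i)) ≤ pers x :=
  Finset.single_le_sum (f := fun i => sqDist (x i) (projDiag (x i)))
    (fun i _ => sqDist_projDiag_nonneg (x i)) (Finset.mem_univ i)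

theorem mass_nonneg {P : Matrix ι κ ℝ} (hP : P ∈ partialPlans ι κ) : 0 ≤ mass P :=
  Finset.sum_nonneg fun i _ => Finset.sum_nonneg fun j _ => hP.1 i j

theorem mass_le {P : Matrix ι κ ℝ} (hP : P ∈ partialPlans ι κ) : mass P ≤ Fintype.card κ := by
  calc mass P = ∑ j, ∑ i, P i j := Finset.sum_comm
    _ ≤ ∑ j : κ, 1 := Finset.sum_le_sum fun j _ => hP.2.1 j
    _ = _ := by simp

/-- The logarithmic shift of the cost caused by adding points of total persistence `pers r`. -/
def costShift (ε : ℝ) (x : ι → ℝ × ℝ) (r : ρ → ℝ × ℝ) : ℝ :=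
  ε / 2 * (Real.log (pers x + pers r) - Real.log (pers x))

theorem costShift_nonneg {ε : ℝ} (hε : 0 < ε) {x : ι → ℝ × ℝ} (hx : 0 < pers x)
    (r : ρ → ℝ × ℝ) : 0 ≤ costShift ε x r := by
  have := Real.log_le_log hx (le_add_of_nonneg_right (pers_nonneg r))
  have := sub_nonneg.2 this
  unfold costShift
  positivity

theorem costShift_le {ε c : ℝ} (hε : 0 < ε) (hc : 0 < c) {x : ι → ℝ × ℝ} (hx : c ≤ pers x)
    (r : ρ → ℝ × ℝ) : costShift ε x r ≤ ε / 2 * (pers r / c) := by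
  have hx0 := hc.trans_le hx
  have hr := pers_nonneg r
  have h1 : Real.log (pers x + pers r) - Real.log (pers x) ≤ pers r / c := by
    rw [← Real.log_div (by positivity) hx0.ne']
    refine (Real.log_le_sub_one_of_pos (by positivity)).trans ?_
    rw [add_div, div_self hx0.ne', add_sub_cancel_left]
    exact div_le_div_of_nonneg_left hr hc hx
  unfold costShift
  gcongr

theorem entropicCost_sumElim (ε : ℝ) (x : ι → ℝ × ℝ) (r : ρ → ℝ × ℝ) (y : κ → ℝ × ℝ)
    (P : Matrix (ι ⊕ ρ) κ ℝ) :
    entropicCost ε (effCost ε (Sum.elim x r) y) P =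
      entropicCost ε (effCost ε x y) (fun i => P (Sum.inl i))
        + costShift ε x r * mass (fun i => P (Sum.inl i))
        + entropicCost ε (fun k => effCost ε (Sum.elim x r) y (Sum.inr k))
            (fun k => P (Sum.inr k)) := by
  have h : entropicCost ε (fun i => effCost ε (Sum.elim x r) y (Sum.inl i))
        (fun i => P (Sum.inl i))
      = entropicCost ε (effCost ε x y) (fun i => P (Sum.inl i))
        + costShift ε x r * mass (fun i => P (Sum.inl i)) := by
    unfold entropicCost mass
    simp only [Finset.mul_sum, ← Finset.sum_add_distrib]
    refine Finset.sum_congr rfl fun i _ => Finset.sum_congr rfl fun j _ => ?_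
    simp only [effCost, costShift, pers_sumElim, Sum.elim_inl]
    ring
  rw [← h]
  unfold entropicCost
  rw [Fintype.sum_sum_type]

/-- Young's inequality for the entropy. -/
theorem neg_exp_le_mul_log {ε : ℝ} (hε : 0 < ε) (c : ℝ) {s : ℝ} (hs : 0 ≤ s) :
    -(ε * Real.exp (-1 - c / ε)) ≤ c * s + ε * (s * Real.log s) := by
  rcases hs.eq_or_lt with rfl | hs
  · have := Real.exp_pos (-1 - c / ε)
    simp; positivity
  · have h := Real.add_one_le_exp (-1 - c / ε - Real.log s)
    rw [Real.exp_sub, Real.exp_log hs, le_div_iff₀ hs] at h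
    have h2 := mul_le_mul_of_nonneg_left h hε.le
    have h3 : ε * ((-1 - c / ε - Real.log s + 1) * s) = -(c * s + ε * (s * Real.log s)) := by
      field_simp; ring
    linarith

/-- Each cell is minimized separately by Young's inequality. The logarithms of the weights in the
effective cost turn the resulting exponential into the product of the two weights, up to `exp (2 * D
/ ε) / c`, so the sum over cells is proportional to `pers r`. Homogeneity of the regularization is
what makes this work. -/
theorem entropicCost_inr_ge {ε c D : ℝ} (hε : 0 < ε) (hc : 0 < c) {x : ι → ℝ × ℝ}
    {r : ρ → ℝ × ℝ} {y : κ → ℝ × ℝ} (hr : ∀ k, r k ∈ Omega) (hy : ∀ j, y j ∈ Omega)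
    (hxc : c ≤ pers x) (hyc : c ≤ pers y) (hrD : pers r ≤ D) (hyD : pers y ≤ D)
    {P : Matrix ρ κ ℝ} (hP : ∀ k j, 0 ≤ P k j) :
    -(ε * Real.exp (2 * D / ε) * (D / c) * pers r) ≤
      entropicCost ε (fun k => effCost ε (Sum.elim x r) y (Sum.inr k)) P := by
  have hterm (k : ρ) (j : κ) :
      -(ε * (Real.exp (2 * D / ε) * (sqDist (r k) (projDiag (r k)) *
        sqDist (y j) (projDiag (y j)) / c))) ≤
      effCost ε (Sum.elim x r) y (Sum.inr k) j * P k j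
        + ε * (P k j * Real.log (P k j)) := by
    refine le_trans ?_ (neg_exp_le_mul_log hε _ (hP k j))
    have ha := sqDist_projDiag_pos (hr k)
    have hb := sqDist_projDiag_pos (hy j)
    have haD := (sqDist_projDiag_le_pers r k).trans hrD
    have hbD := (sqDist_projDiag_le_pers y j).trans hyD
    have hl1 : Real.log c ≤ Real.log (pers x + pers r) :=
      Real.log_le_log hc (hxc.trans (le_add_of_nonneg_right (pers_nonneg r)))
    have hl2 : Real.log c ≤ Real.log (pers y) := Real.log_le_log hc hyc
    have hd : 0 ≤ sqDist (r k) (y j) := by unfold sqDist; positivity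
    refine neg_le_neg (mul_le_mul_of_nonneg_left ?_ hε.le)
    calc Real.exp (-1 - effCost ε (Sum.elim x r) y (Sum.inr k) j / ε)
        ≤ Real.exp (2 * D / ε + (Real.log (sqDist (r k) (projDiag (r k)))
            + Real.log (sqDist (y j) (projDiag (y j))) - Real.log c)) := by
          refine Real.exp_le_exp.2 ?_
          have he : -1 - effCost ε (Sum.elim x r) y (Sum.inr k) j / ε =
              (sqDist (r k) (projDiag (r k)) + sqDist (y j) (projDiag (y j))
                - sqDist (r k) (y j)) / ε
              + (Real.log (sqDist (r k) (projDiag (r k)))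
                + Real.log (sqDist (y j) (projDiag (y j)))
                - (Real.log (pers x + pers r) + Real.log (pers y)) / 2) := by
            simp only [effCost, pers_sumElim, Sum.elim_inr]
            field_simp
            ring
          rw [he]
          have : (sqDist (r k) (projDiag (r k)) + sqDist (y j) (projDiag (y j))
                - sqDist (r k) (y j)) / ε ≤ 2 * D / ε := by
            gcongr; linarith
          linarith
      _ = _ := by
          rw [Real.exp_add, Real.exp_sub, Real.exp_add, Real.exp_log ha, Real.exp_log hb,
            Real.exp_log hc]
  have hsum := Finset.sum_le_sum fun k (_ : k ∈ Finset.univ) =>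
    Finset.sum_le_sum fun j (_ : j ∈ Finset.univ) => hterm k j
  refine le_trans ?_ hsum
  have : ∑ k, ∑ j, -(ε * (Real.exp (2 * D / ε) * (sqDist (r k) (projDiag (r k)) *
        sqDist (y j) (projDiag (y j)) / c)))
      = -(ε * Real.exp (2 * D / ε) * (pers y / c) * pers r) := by
    have hrw : pers y / c * pers r = ∑ k, ∑ j, sqDist (r k) (projDiag (r k)) *
        sqDist (y j) (projDiag (y j)) / c := by
      rw [div_mul_eq_mul_div, mul_comm (pers y), pers, pers, Finset.sum_mul_sum]
      simp only [Finset.sum_div]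
    rw [mul_assoc, hrw]
    simp only [Finset.mul_sum, Finset.sum_neg_distrib, mul_assoc]
  rw [this]
  have hr0 := pers_nonneg r
  gcongr

/-- Adding points to a diagram changes the regularized cost at most proportionally to their total
persistence. -/
theorem abs_FGfam_sumElim_sub_le {ε c D : ℝ} (hε : 0 < ε) (hc : 0 < c) {x : ι → ℝ × ℝ}
    {r : ρ → ℝ × ℝ} {y : κ → ℝ × ℝ} (hx : ∀ i, x i ∈ Omega) (hr : ∀ k, r k ∈ Omega)
    (hy : ∀ j, y j ∈ Omega) [Nonempty ι] [Nonempty κ] (hxc : c ≤ pers x) (hyc : c ≤ pers y)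
    (hrD : pers r ≤ D) (hyD : pers y ≤ D) {N : ℕ} (hN : Fintype.card κ ≤ N) :
    |FGfam ε (Sum.elim x r) y - FGfam ε x y| ≤
      (1 + ε / 2 + ε * N / (2 * c) + ε * Real.exp (2 * D / ε) * (D / c)) * pers r := by
  have hxr : ∀ i, Sum.elim x r i ∈ Omega := by rintro (i | k); exacts [hx i, hr k]
  have hr0 := pers_nonneg r
  have hD : 0 ≤ D := hr0.trans hrD
  rw [FGfam_eq ε hxr hy, FGfam_eq ε hx hy, pers_sumElim]
  have hθ := costShift_nonneg hε (hc.trans_le hxc) r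
  have hθ' := costShift_le hε hc hxc r
  have hN' : (Fintype.card κ : ℝ) ≤ N := by exact_mod_cast hN
  have hupper : minCost ε (effCost ε (Sum.elim x r) y) ≤
      minCost ε (effCost ε x y) + ε / 2 * (pers r / c) * N := by
    obtain ⟨P, hP⟩ := exists_isMinimizer ε (effCost ε x y)
    -- Zero rows send the new points to the diagonal, so only the logarithmic shift is paid.
    have hmem : Matrix.fromRows P (0 : Matrix ρ κ ℝ) ∈ partialPlans (ι ⊕ ρ) κ := by
      refine ⟨?_, fun j => ?_, ?_⟩
      · rintro (i | k) j
        · exact hP.1.1 i j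
        · simp
      · simpa [Fintype.sum_sum_type] using hP.1.2.1 j
      · rintro (i | k)
        · exact hP.1.2.2 i
        · simp
    have hcost : entropicCost ε (effCost ε (Sum.elim x r) y) (Matrix.fromRows P 0) =
        minCost ε (effCost ε x y) + costShift ε x r * mass P := by
      rw [entropicCost_sumElim, hP.minCost_eq]
      have : (fun i => Matrix.fromRows P (0 : Matrix ρ κ ℝ) (Sum.inl i)) = P := rfl
      rw [this]
      simp [entropicCost]
    refine (minCost_le ε _ hmem).trans ?_
    rw [hcost]
    have := mul_le_mul hθ' ((mass_le hP.1).trans hN') (mass_nonneg hP.1) (by positivity)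
    linarith
  have hlower : minCost ε (effCost ε x y) - ε * Real.exp (2 * D / ε) * (D / c) * pers r ≤
      minCost ε (effCost ε (Sum.elim x r) y) := by
    obtain ⟨P, hP⟩ := exists_isMinimizer ε (effCost ε (Sum.elim x r) y)
    -- Deleting the new rows keeps the plan feasible; the shift is nonnegative and the deleted cells
    -- are bounded below.
    have hmem : (fun i => P (Sum.inl i) : Matrix ι κ ℝ) ∈ partialPlans ι κ := by
      refine ⟨fun i j => hP.1.1 _ j, fun j => ?_, fun i => hP.1.2.2 _⟩
      have := hP.1.2.1 j
      rw [Fintype.sum_sum_type] at this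
      have h0 : 0 ≤ ∑ k, P (Sum.inr k) j := Finset.sum_nonneg fun k _ => hP.1.1 _ j
      linarith
    rw [hP.minCost_eq, entropicCost_sumElim]
    have h1 := minCost_le ε (effCost ε x y) hmem
    have h2 := mul_nonneg hθ (mass_nonneg hmem)
    have h3 := entropicCost_inr_ge hε hc hr hy hxc hyc hrD hyD
      (P := fun k => P (Sum.inr k)) fun k j => hP.1.1 _ j
    linarith
  have e : ε / 2 * (pers r / c) * N = ε * N / (2 * c) * pers r := by field_simp
  have hpos : 0 ≤ ε * N / (2 * c) * pers r := by positivity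
  have hpos' : 0 ≤ ε * Real.exp (2 * D / ε) * (D / c) * pers r := by positivity
  have hpos'' : 0 ≤ (1 + ε / 2) * pers r := by positivity
  rw [e] at hupper
  rw [abs_le]
  constructor <;> linarith

end Perturbation

/-! ### First variation of the regularized cost. -/

section Gradient

variable {ι κ : Type*} [Fintype ι] [Fintype κ]

/-- The first variation of `pers` at `x` in the direction `ξ`. -/
def persVar (x ξ : ι → ℝ × ℝ) : ℝ := ∑ i, ((x i).2 - (x i).1) * ((ξ i).2 - (ξ i).1)

/-- The first variation of `effCost` at `(x, y)` in the direction `(ξ, η)`. -/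
def effCostVar (ε : ℝ) (x ξ : ι → ℝ × ℝ) (y η : κ → ℝ × ℝ) (i : ι) (j : κ) : ℝ :=
  2 * ((x i).1 - (y j).1) * ((ξ i).1 - (η j).1) + 2 * ((x i).2 - (y j).2) * ((ξ i).2 - (η j).2)
    - ((x i).2 - (x i).1) * ((ξ i).2 - (ξ i).1) - ((y j).2 - (y j).1) * ((η j).2 - (η j).1)
    - ε * (2 / ((x i).2 - (x i).1) * ((ξ i).2 - (ξ i).1)
      + 2 / ((y j).2 - (y j).1) * ((η j).2 - (η j).1))
    + ε / 2 * (persVar x ξ / pers x + persVar y η / pers y)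

variable {E : Type*} [NormedAddCommGroup E] [NormedSpace ℝ E]

theorem exists_hasFDerivAt_pers {x : E → ι → ℝ × ℝ} {x' : ι → E →L[ℝ] ℝ × ℝ} {q : E}
    (hx' : ∀ i, HasFDerivAt (fun q => x q i) (x' i) q) :
    ∃ l : E →L[ℝ] ℝ, HasFDerivAt (fun q => pers (x q)) l q ∧
      ∀ v, l v = persVar (x q) fun i => x' i v := by
  have h (i : ι) := (((hx' i).snd.sub (hx' i).fst).pow 2).mul_const (1 / 2 : ℝ)
  have hs := HasFDerivAt.fun_sum (u := Finset.univ) fun i _ => h i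
  refine ⟨_, hs.congr_of_eventuallyEq (Filter.Eventually.of_forall fun q => ?_), fun v => ?_⟩
  · simp [pers, sqDist_projDiag, div_eq_mul_inv]
  · simp only [persVar]
    simp
    exact Finset.sum_congr rfl fun i _ => by ring

theorem exists_hasFDerivAt_effCost (ε : ℝ) {x : E → ι → ℝ × ℝ} {x' : ι → E →L[ℝ] ℝ × ℝ}
    {y : E → κ → ℝ × ℝ} {y' : κ → E →L[ℝ] ℝ × ℝ} {q : E}
    (hx' : ∀ i, HasFDerivAt (fun q => x q i) (x' i) q)
    (hy' : ∀ j, HasFDerivAt (fun q => y q j) (y' j) q)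
    (hx : ∀ i, x q i ∈ Omega) (hy : ∀ j, y q j ∈ Omega) [Nonempty ι] [Nonempty κ]
    (i : ι) (j : κ) :
    ∃ l : E →L[ℝ] ℝ, HasFDerivAt (fun q => effCost ε (x q) (y q) i j) l q ∧
      ∀ v, l v = effCostVar ε (x q) (fun i => x' i v) (y q) (fun j => y' j v) i j := by
  obtain ⟨px, hpx, hpx'⟩ := exists_hasFDerivAt_pers hx'
  obtain ⟨py, hpy, hpy'⟩ := exists_hasFDerivAt_pers hy'
  have ux : 0 < (x q i).2 - (x q i).1 := sub_pos.2 (hx i)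
  have uy : 0 < (y q j).2 - (y q j).1 := sub_pos.2 (hy j)
  have hax := (((hx' i).snd.sub (hx' i).fst).pow 2).mul_const (1 / 2 : ℝ)
  have hay := (((hy' j).snd.sub (hy' j).fst).pow 2).mul_const (1 / 2 : ℝ)
  have hd := (((hx' i).fst.sub (hy' j).fst).pow 2).add (((hx' i).snd.sub (hy' j).snd).pow 2)
  have hlx := hax.log (by simp; positivity)
  have hly := hay.log (by simp; positivity)
  have h := ((((hd.sub hax).sub hay).sub ((hlx.add hly).const_mul ε)).add
    (((hpx.log (pers_pos hx).ne').add (hpy.log (pers_pos hy).ne')).const_mul (ε / 2))).sub_const ε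
  refine ⟨_, h.congr_of_eventuallyEq (Filter.Eventually.of_forall fun q => ?_), fun v => ?_⟩
  · simp [effCost, sqDist_projDiag, div_eq_mul_inv]
    simp [sqDist]
  · simp [effCostVar]
    rw [hpx', hpy']
    have h1 := ux.ne'
    have h2 := uy.ne'
    have h3 := (pers_pos hx).ne'
    have h4 := (pers_pos hy).ne'
    field_simp

/-- By Danskin's theorem and the chain rule, only the cost is differentiated: no derivative of the
plan appears. -/
theorem exists_hasFDerivAt_FGfam {ε : ℝ} (hε : 0 < ε) {x : E → ι → ℝ × ℝ}
    {x' : ι → E →L[ℝ] ℝ × ℝ} {y : E → κ → ℝ × ℝ} {y' : κ → E →L[ℝ] ℝ × ℝ} {q : E}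
    (hx' : ∀ i, HasFDerivAt (fun q => x q i) (x' i) q)
    (hy' : ∀ j, HasFDerivAt (fun q => y q j) (y' j) q)
    (hx : ∀ᶠ q' in nhds q, ∀ i, x q' i ∈ Omega) (hy : ∀ᶠ q' in nhds q, ∀ j, y q' j ∈ Omega)
    [Nonempty ι] [Nonempty κ] :
    ∃ l : E →L[ℝ] ℝ, HasFDerivAt (fun q => FGfam ε (x q) (y q)) l q ∧
      ∀ v, l v = (1 + ε / 2) * (persVar (x q) (fun i => x' i v) + persVar (y q) (fun j => y' j v))
        + ∑ i, ∑ j, optimalPlan ε (x q) (y q) i j *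
          effCostVar ε (x q) (fun i => x' i v) (y q) (fun j => y' j v) i j := by
  obtain ⟨px, hpx, hpx'⟩ := exists_hasFDerivAt_pers hx'
  obtain ⟨py, hpy, hpy'⟩ := exists_hasFDerivAt_pers hy'
  choose l hl hl' using exists_hasFDerivAt_effCost ε hx' hy' hx.self_of_nhds hy.self_of_nhds
  have hc : HasFDerivAt (fun q => effCost ε (x q) (y q))
      (ContinuousLinearMap.pi fun i => ContinuousLinearMap.pi fun j => l i j) q :=
    hasFDerivAt_pi.2 fun i => hasFDerivAt_pi.2 fun j => hl i j
  have hm := (isMinimizer_optimalPlan hε hx.self_of_nhds hy.self_of_nhds).hasFDerivAt_minCost hε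
  have h := ((hpx.add hpy).const_mul (1 + ε / 2)).add (hm.comp q hc)
  refine ⟨_, h.congr_of_eventuallyEq ?_, fun v => ?_⟩
  · filter_upwards [hx, hy] with q' hx hy
    rw [FGfam_eq ε hx hy]
    rfl
  · simp [hpx', hpy', hl', mul_add]

/-- Collects the one-sided variation by `ξ i`. The identity `2(bξ₁ + dξ₂) - (d - b)(ξ₂ - ξ₁) = (b +
d)(ξ₁ + ξ₂)` turns the row-mass terms into pairings with `projDiag`, which is how the barycentric
map arises. -/
theorem persVar_add_sum_eq (ε : ℝ) (x ξ : ι → ℝ × ℝ) (y : κ → ℝ × ℝ) (P : Matrix ι κ ℝ) :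
    (1 + ε / 2) * persVar x ξ + ∑ i, ∑ j, P i j *
      (2 * ((x i).1 - (y j).1) * (ξ i).1 + 2 * ((x i).2 - (y j).2) * (ξ i).2
        - ((x i).2 - (x i).1) * ((ξ i).2 - (ξ i).1)
        - ε * (2 / ((x i).2 - (x i).1) * ((ξ i).2 - (ξ i).1)) + ε / 2 * (persVar x ξ / pers x))
    = ∑ i, ((1 + ε / 2 + ε / 2 * (mass P / pers x)) * ((x i).2 - (x i).1) * ((ξ i).2 - (ξ i).1)
        - ε * (2 / ((x i).2 - (x i).1)) * rowMass P i * ((ξ i).2 - (ξ i).1)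
        + rowMass P i * ((x i).1 + (x i).2) * ((ξ i).1 + (ξ i).2)
        - 2 * ((∑ j, P i j * (y j).1) * (ξ i).1 + (∑ j, P i j * (y j).2) * (ξ i).2)) := by
  have hrow (i : ι) : ∑ j, P i j *
      (2 * ((x i).1 - (y j).1) * (ξ i).1 + 2 * ((x i).2 - (y j).2) * (ξ i).2
        - ((x i).2 - (x i).1) * ((ξ i).2 - (ξ i).1)
        - ε * (2 / ((x i).2 - (x i).1) * ((ξ i).2 - (ξ i).1)) + ε / 2 * (persVar x ξ / pers x))
      = rowMass P i * ((x i).1 + (x i).2) * ((ξ i).1 + (ξ i).2)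
        - ε * (2 / ((x i).2 - (x i).1)) * rowMass P i * ((ξ i).2 - (ξ i).1)
        + ε / 2 * (persVar x ξ / pers x) * rowMass P i
        - 2 * ((∑ j, P i j * (y j).1) * (ξ i).1 + (∑ j, P i j * (y j).2) * (ξ i).2) := by
    simp only [rowMass, Finset.sum_mul, Finset.mul_sum, ← Finset.sum_add_distrib,
      ← Finset.sum_sub_distrib]
    exact Finset.sum_congr rfl fun j _ => by ring
  have hmass : mass P = ∑ i, rowMass P i := rfl
  have hpv : ∑ i, (1 + ε / 2 + ε / 2 * (mass P / pers x)) * ((x i).2 - (x i).1)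
      * ((ξ i).2 - (ξ i).1) = (1 + ε / 2 + ε / 2 * (mass P / pers x)) * persVar x ξ := by
    simp only [persVar, Finset.mul_sum, mul_assoc]
  simp only [hrow, Finset.sum_add_distrib, Finset.sum_sub_distrib, hpv]
  rw [← Finset.mul_sum, ← hmass]
  ring

/-- The two-sided variation is a one-sided one plus its transpose, and a symmetric plan weighs both
equally. -/
theorem sum_mul_effCostVar_self (ε : ℝ) (x ξ : ι → ℝ × ℝ) {P : Matrix ι ι ℝ}
    (hP : ∀ i j, P i j = P j i) :
    ∑ i, ∑ j, P i j * effCostVar ε x ξ x ξ i j = 2 * ∑ i, ∑ j, P i j *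
      (2 * ((x i).1 - (x j).1) * (ξ i).1 + 2 * ((x i).2 - (x j).2) * (ξ i).2
        - ((x i).2 - (x i).1) * ((ξ i).2 - (ξ i).1)
        - ε * (2 / ((x i).2 - (x i).1) * ((ξ i).2 - (ξ i).1))
        + ε / 2 * (persVar x ξ / pers x)) := by
  rw [two_mul]
  conv_rhs => arg 2; rw [Finset.sum_comm]
  simp only [← Finset.sum_add_distrib]
  refine Finset.sum_congr rfl fun i _ => Finset.sum_congr rfl fun j _ => ?_
  rw [hP j i, effCostVar]
  ring

/-- The gradient of the Sinkhorn divergence with respect to the points of the first diagram. -/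
theorem hasFDerivAt_FGfam_sub_half_self {ε : ℝ} (hε : 0 < ε) {x : E → ι → ℝ × ℝ}
    {x' : ι → E →L[ℝ] ℝ × ℝ} {y : κ → ℝ × ℝ} {q : E}
    (hx' : ∀ i, HasFDerivAt (fun q => x q i) (x' i) q)
    (hx : ∀ᶠ q' in nhds q, ∀ i, x q' i ∈ Omega) (hy : ∀ j, y j ∈ Omega)
    [Nonempty ι] [Nonempty κ] :
    HasFDerivAt (fun q => FGfam ε (x q) y - 1 / 2 * FGfam ε (x q) (x q))
      (∑ i, ((gradSFGfam ε (x q) y i).1 • (ContinuousLinearMap.fst ℝ ℝ ℝ ∘L x' i)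
        + (gradSFGfam ε (x q) y i).2 • (ContinuousLinearMap.snd ℝ ℝ ℝ ∘L x' i))) q := by
  obtain ⟨l, hl, hl'⟩ := exists_hasFDerivAt_FGfam hε hx'
    (fun j => hasFDerivAt_const (y j) q) hx (Filter.Eventually.of_forall fun _ => hy)
  obtain ⟨m, hm, hm'⟩ := exists_hasFDerivAt_FGfam hε hx' hx' hx hx
  refine (hl.sub (hm.const_mul (1 / 2))).congr_fderiv (ContinuousLinearMap.ext fun v => ?_)
  set ξ : ι → ℝ × ℝ := fun i => x' i v with hξ
  have e1 : l v = _ := (hl' v).trans (Eq.trans ?_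
    (persVar_add_sum_eq ε (x q) ξ y (optimalPlan ε (x q) y)))
  swap
  · simp [persVar, effCostVar, hξ]
  have e2 : m v = _ := hm' v
  rw [sum_mul_effCostVar_self ε _ _ (optimalPlan_symm hε hx.self_of_nhds)] at e2
  have e3 := persVar_add_sum_eq ε (x q) ξ (x q) (optimalPlan ε (x q) (x q))
  have e4 : (l - (1 / 2 : ℝ) • m) v = l v - 1 / 2 * m v := by simp
  rw [e4, e1, e2]
  simp only [← hξ]
  -- The factor `1 / 2` undoes the doubling and leaves the one-sided variation against a frozen copy
  -- of `x q`.
  rw [show ∀ a s : ℝ, 1 / 2 * ((1 + ε / 2) * (a + a) + 2 * s) = (1 + ε / 2) * a + s by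
    intro a s; ring, e3, ← Finset.sum_sub_distrib, sum_apply]
  refine Finset.sum_congr rfl fun i _ => ?_
  simp [gradSFGfam, baryMap, entropicCorrection, projDiag, Prod.fst_sum, Prod.snd_sum]
  ring

end Gradient

/-! ### Diagrams listed as families. -/

section Reindexing

/-- Every value has equally many preimages under both families, so bijections of the fibres can be
glued. -/
theorem exists_equiv_pts {ι : Type*} [Fintype ι] {x : ι → ℝ × ℝ} {α : Multiset (ℝ × ℝ)}
    (h : Finset.univ.val.map x = α) : ∃ e : ι ≃ α, pts α ∘ e = x := by
  classical
  have hcard (z : ℝ × ℝ) : Nonempty ({i // x i = z} ≃ {a // pts α a = z}) := by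
    refine ⟨Fintype.equivOfCardEq ?_⟩
    have h1 : (Finset.univ.val.map x).count z = (Finset.univ.val.map (pts α)).count z := by
      rw [h, map_pts_univ]
    rw [Multiset.count_map, Multiset.count_map] at h1
    rw [Fintype.card_subtype, Fintype.card_subtype, Finset.card_def, Finset.card_def,
      Finset.filter_val, Finset.filter_val]
    simpa only [eq_comm] using h1
  let g (z : ℝ × ℝ) := (hcard z).some
  refine ⟨((Equiv.sigmaFiberEquiv x).symm.trans (Equiv.sigmaCongrRight g)).trans
    (Equiv.sigmaFiberEquiv (pts α)), funext fun i => ?_⟩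
  exact (g (x i) ⟨i, rfl⟩).2

theorem pers_pts_le (R : Multiset (ℝ × ℝ)) {s : ℝ}
    (h : ∀ z ∈ R, sqDist z (projDiag z) ≤ s) : pers (pts R) ≤ R.card * s := by
  refine (Finset.sum_le_card_nsmul _ _ s fun i _ => h _ (pts_mem R i)).trans ?_
  simp

variable {ι : Type*} [Fintype ι]

theorem exists_equiv_sumElim_pts {x : ι → ℝ × ℝ} {α R : Multiset (ℝ × ℝ)}
    (h : α = Finset.univ.val.map x + R) :
    ∃ e : ι ⊕ R ≃ α, pts α ∘ e = Sum.elim x (pts R) := by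
  refine exists_equiv_pts ?_
  rw [h]
  have : (Finset.univ : Finset (ι ⊕ R)).val =
      (Finset.univ : Finset ι).val.disjSum (Finset.univ : Finset R).val := rfl
  rw [this, Multiset.disjSum, Multiset.map_add, Multiset.map_map, Multiset.map_map]
  congr 1
  exact map_pts_univ R

theorem SFG_eq_of_eq_add (ε : ℝ) {x : ι → ℝ × ℝ} {α β R : Multiset (ℝ × ℝ)}
    (h : α = Finset.univ.val.map x + R) :
    SFG ε α β = FGfam ε (Sum.elim x (pts R)) (pts β)
      - 1 / 2 * FGfam ε (Sum.elim x (pts R)) (Sum.elim x (pts R)) - 1 / 2 * FG ε β β := by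
  obtain ⟨e, he⟩ := exists_equiv_sumElim_pts h
  rw [← he, FGfam_reindex, ← Function.comp_id (pts β), ← Equiv.coe_refl, FGfam_reindex]
  rfl

end Reindexing

/-! ### Stability of the Sinkhorn divergence. -/

section Perturbation

variable {ι κ ρ : Type*} [Fintype ι] [Fintype κ] [Fintype ρ]

theorem abs_sinkhorn_sumElim_sub_le {ε c D : ℝ} (hε : 0 < ε) (hc : 0 < c) {x : ι → ℝ × ℝ}
    {r : ρ → ℝ × ℝ} {y : κ → ℝ × ℝ} (hx : ∀ i, x i ∈ Omega) (hr : ∀ k, r k ∈ Omega)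
    (hy : ∀ j, y j ∈ Omega) [Nonempty ι] [Nonempty κ] (hxc : c ≤ pers x) (hyc : c ≤ pers y)
    (hxD : pers x + pers r ≤ D) (hyD : pers y ≤ D) {N : ℕ} (hN : Fintype.card κ ≤ N)
    (hN' : Fintype.card (ι ⊕ ρ) ≤ N) :
    |(FGfam ε (Sum.elim x r) y - 1 / 2 * FGfam ε (Sum.elim x r) (Sum.elim x r))
      - (FGfam ε x y - 1 / 2 * FGfam ε x x)| ≤
      2 * ((1 + ε / 2 + ε * N / (2 * c) + ε * Real.exp (2 * D / ε) * (D / c)) * pers r) := by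
  have hxr : ∀ i, Sum.elim x r i ∈ Omega := by rintro (i | k); exacts [hx i, hr k]
  have hx0 := pers_nonneg x
  have hr0 := pers_nonneg r
  have hrD : pers r ≤ D := by linarith
  have hpe := pers_sumElim x r
  have h1 := abs_FGfam_sumElim_sub_le hε hc hx hr hy hxc hyc hrD hyD hN
  have h2 := abs_FGfam_sumElim_sub_le hε hc hx hr hxr hxc (by linarith) hrD (by linarith) hN'
  have h3 := abs_FGfam_sumElim_sub_le hε hc hx hr hx hxc hxc hrD (by linarith)
    (N := N) (le_trans (by simp) hN')
  -- Symmetry lets the two arguments of the self term be enlarged one at a time.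
  rw [FGfam_comm ε hx hxr] at h2
  rw [abs_le] at *
  constructor <;> linarith [h1.1, h1.2, h2.1, h2.2, h3.1, h3.2]

end Perturbation

/-! ### Edge lengths when one point moves. -/

section Distances

variable {n m : ℕ} {P : Fin n → EuclideanSpace ℝ (Fin m)}

theorem hasFDerivAt_norm_of_ne {F : Type*} [NormedAddCommGroup F] [InnerProductSpace ℝ F] {v : F}
    (hv : v ≠ 0) : HasFDerivAt (fun v : F => ‖v‖) ((1 / ‖v‖) • innerSL ℝ v) v := by
  have hn : ‖v‖ ^ 2 ≠ 0 := by positivity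
  have h := (hasStrictFDerivAt_norm_sq v).hasFDerivAt.sqrt hn
  refine (h.congr_of_eventuallyEq (Filter.Eventually.of_forall fun w => ?_)).congr_fderiv ?_
  · simp
  · ext w
    simp
    field_simp

theorem hasFDerivAt_dist_update (hP : Function.Injective P) (i : Fin n) (e : Fin n × Fin n) :
    HasFDerivAt (fun q => dist (Function.update P i q e.1) (Function.update P i q e.2))
      (innerSL ℝ (edgeGrad P e i)) (P i) := by
  obtain ⟨a, b⟩ := e
  rcases eq_or_ne a b with rfl | hab
  -- Equal endpoints keep length `0`; this is the case of birth value `0`.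
  · simpa [edgeGrad] using hasFDerivAt_const (0 : ℝ) (P i)
  have hne : P a - P b ≠ 0 := sub_ne_zero.2 (hP.ne hab)
  by_cases hia : i = a
  · subst hia
    have h := (hasFDerivAt_norm_of_ne hne).comp (P i) ((hasFDerivAt_id (P i)).sub_const (P b))
    refine (h.congr_of_eventuallyEq (Filter.Eventually.of_forall fun q => ?_)).congr_fderiv ?_
    · simp [hab.symm, dist_eq_norm]
    · ext v
      simp [edgeGrad, hab]
  by_cases hib : i = b
  · subst hib
    have h := (hasFDerivAt_norm_of_ne hne).comp (P i) ((hasFDerivAt_id (P i)).const_sub (P a))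
    refine (h.congr_of_eventuallyEq (Filter.Eventually.of_forall fun q => ?_)).congr_fderiv ?_
    · simp [hab, dist_eq_norm]
    · ext v
      simp [edgeGrad, hia]
      ring
  · simpa [edgeGrad, hia, hib, Ne.symm hia, Ne.symm hib] using
      hasFDerivAt_const (dist (P a) (P b)) (P i)

theorem abs_dist_update_sub_le (i : Fin n) (q : EuclideanSpace ℝ (Fin m)) (a b : Fin n) :
    |dist (Function.update P i q a) (Function.update P i q b) - dist (P a) (P b)|
      ≤ ‖q - P i‖ := by
  have h0 := norm_nonneg (q - P i)
  rcases eq_or_ne a b with rfl | hab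
  · simp
  by_cases ha : a = i
  · subst ha
    rw [Function.update_self, Function.update_of_ne hab.symm, ← dist_eq_norm]
    exact abs_dist_sub_le _ _ _
  by_cases hb : b = i
  · subst hb
    rw [Function.update_self, Function.update_of_ne ha, ← dist_eq_norm, dist_comm (P a),
      dist_comm (P a)]
    exact abs_dist_sub_le _ _ _
  · simp [ha, hb]

/-- The pairwise distances after moving the `i`-th point to `q`. -/
def movedDist (P : Fin n → EuclideanSpace ℝ (Fin m)) (i : Fin n) (q : EuclideanSpace ℝ (Fin m))
    (a b : Fin n) : ℝ := dist (Function.update P i q a) (Function.update P i q b)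

theorem eventually_refines (P : Fin n → EuclideanSpace ℝ (Fin m)) (i : Fin n) :
    ∀ᶠ q in nhds (P i), Refines (fun a b => dist (P a) (P b)) (movedDist P i q) := by
  have hc (a b : Fin n) : Continuous fun q => movedDist P i q a b := by
    unfold movedDist
    fun_prop
  simp only [Refines, Filter.eventually_all]
  intro u v w z hlt
  refine ((hc u v).tendsto _).eventually_lt ((hc w z).tendsto _) ?_
  simpa [movedDist] using hlt

/-- A nonzero diagram value is the length of a single edge; the value `0` is attained only at equal
indices, where it remains `0`. -/
theorem tied_of_generalPosition (𝕜 : Type*) [Field 𝕜] (hgen : GeneralPosition 𝕜 P) (i : Fin n)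
    (q : EuclideanSpace ℝ (Fin m)) (u v w z : Fin n)
    (h : (dist (P u) (P v), dist (P w) (P z)) ∈ PDof 𝕜 fun a b => dist (P a) (P b)) :
    Tied (fun a b => dist (P a) (P b)) (movedDist P i q) u v ∧
      Tied (fun a b => dist (P a) (P b)) (movedDist P i q) w z := by
  have hs {a b c d : Fin n} (he : s(a, b) = s(c, d)) :
      movedDist P i q a b = movedDist P i q c d := by
    rcases Sym2.eq_iff.1 he with ⟨rfl, rfl⟩ | ⟨rfl, rfl⟩
    · rfl
    · exact dist_comm _ _
  obtain ⟨h1, h2⟩ := hgen.2 _ h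
  constructor
  · intro a b hab
    by_cases h0 : dist (P u) (P v) = 0
    · have huv : u = v := hgen.1 (dist_eq_zero.1 h0)
      have hab' : a = b := hgen.1 (dist_eq_zero.1 (hab.trans h0))
      simp [movedDist, huv, hab']
    · exact hs (h1 h0 _ _ _ _ hab rfl)
  · intro a b hab
    exact hs (h2 _ _ _ _ hab rfl)

theorem PD_ne_zero (𝕜 : Type*) [Field 𝕜] (hP : Function.Injective P) (hn : 2 ≤ n) :
    PD 𝕜 P ≠ 0 :=
  PDof_ne_zero 𝕜 hn (fun _ => dist_self _) (fun _ _ h => dist_pos.2 (hP.ne h))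
    fun _ _ => dist_comm _ _

theorem graphPD_ne_zero (𝕜 : Type*) [Field 𝕜] {γ ν : ℝ} (hγ : 0 < γ) (G : WeightedGraph n)
    (hn : 2 ≤ n) : graphPD 𝕜 γ ν G ≠ 0 := by
  refine PDof_ne_zero 𝕜 hn (fun u => if_pos rfl) (fun u v h => ?_) fun u v => ?_
  · have := G.nonneg u v
    rw [if_neg h]
    positivity
  · simp only [G.symm u v, eq_comm]

theorem pts_PDof_mem_Omega (𝕜 : Type*) [Field 𝕜] (δ : Fin n → Fin n → ℝ) (x : PDof 𝕜 δ) :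
    pts (PDof 𝕜 δ) x ∈ Omega := (mem_PDof 𝕜 (pts_mem _ x)).2.2

end Distances

/-! ### Differentiating the topological loss. -/

section Loss

variable (𝕜 : Type*) [Field 𝕜] {n m : ℕ} {P : Fin n → EuclideanSpace ℝ (Fin m)}

/-- The points of the diagram of `P`, moved along with their edges. -/
def movedPts (P : Fin n → EuclideanSpace ℝ (Fin m)) (i : Fin n) (q : EuclideanSpace ℝ (Fin m))
    (x : PD 𝕜 P) : ℝ × ℝ :=
  (movedDist P i q (birthEdge 𝕜 P x).1 (birthEdge 𝕜 P x).2,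
    movedDist P i q (deathEdge 𝕜 P x).1 (deathEdge 𝕜 P x).2)

theorem dist_birthEdge (x : PD 𝕜 P) :
    dist (P (birthEdge 𝕜 P x).1) (P (birthEdge 𝕜 P x).2) = (pts (PD 𝕜 P) x).1 :=
  (exists_birthEdge 𝕜 P x).choose_spec

theorem dist_deathEdge (x : PD 𝕜 P) :
    dist (P (deathEdge 𝕜 P x).1) (P (deathEdge 𝕜 P x).2) = (pts (PD 𝕜 P) x).2 :=
  (exists_deathEdge 𝕜 P x).choose_spec

theorem movedPts_self (i : Fin n) : movedPts 𝕜 P i (P i) = pts (PD 𝕜 P) := by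
  funext x
  simp [movedPts, movedDist, dist_birthEdge, dist_deathEdge]

/-- Near `P i`, the diagram consists of the moved points and of points whose persistence is of
second order. -/
theorem eventually_exists_PD_update_eq (hgen : GeneralPosition 𝕜 P) (i : Fin n) :
    ∀ᶠ q in nhds (P i), (∀ x, movedPts 𝕜 P i q x ∈ Omega) ∧ ∃ R : Multiset (ℝ × ℝ),
      PD 𝕜 (Function.update P i q) = Finset.univ.val.map (movedPts 𝕜 P i q) + R ∧
      (∀ z ∈ R, z ∈ Omega) ∧ ∀ z ∈ R, sqDist z (projDiag z) ≤ 2 * ‖q - P i‖ ^ 2 := by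
  filter_upwards [eventually_refines P i] with q hq
  refine ⟨fun x => hq _ _ _ _ ?_, ?_⟩
  · beta_reduce
    rw [dist_birthEdge, dist_deathEdge]
    exact pts_PDof_mem_Omega 𝕜 _ x
  obtain ⟨R, hR, hR'⟩ := hq.exists_PDof_eq_add 𝕜 (tied_of_generalPosition 𝕜 hgen i q)
    (birthEdge 𝕜 P) (deathEdge 𝕜 P) (dist_birthEdge 𝕜) (dist_deathEdge 𝕜)
  refine ⟨R, hR, fun z hz => (mem_PDof 𝕜 (hR' z hz).1).2.2, fun z hz => ?_⟩
  obtain ⟨hmem, u, v, w, t, rfl, he⟩ := hR' z hz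
  have hlt : movedDist P i q u v < movedDist P i q w t := (mem_PDof 𝕜 hmem).2.2
  have h1 := abs_le.1 (abs_dist_update_sub_le (P := P) i q u v)
  have h2 := abs_le.1 (abs_dist_update_sub_le (P := P) i q w t)
  have h3 : movedDist P i q w t - movedDist P i q u v ≤ 2 * ‖q - P i‖ := by
    unfold movedDist
    linarith [h1.1, h2.2]
  rw [sqDist_projDiag]
  have := pow_le_pow_left₀ (sub_pos.2 hlt).le h3 2
  simp only
  linarith

theorem hasFDerivAt_movedPts (hP : Function.Injective P) (i : Fin n) (x : PD 𝕜 P) :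
    HasFDerivAt (fun q => movedPts 𝕜 P i q x)
      ((innerSL ℝ (edgeGrad P (birthEdge 𝕜 P x) i)).prod
        (innerSL ℝ (edgeGrad P (deathEdge 𝕜 P x) i))) (P i) :=
  (hasFDerivAt_dist_update hP i _).prodMk (hasFDerivAt_dist_update hP i _)

theorem hasGradientAt_SFG_PD {ε : ℝ} (hε : 0 < ε) (hgen : GeneralPosition 𝕜 P)
    {β : Multiset (ℝ × ℝ)} (hβ : ∀ y ∈ β, y ∈ Omega) (hβ0 : 2 ≤ n → β ≠ 0) (i : Fin n) :
    HasGradientAt (fun q => SFG ε (PD 𝕜 (Function.update P i q)) β) (lossGrad 𝕜 P ε β i)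
      (P i) := by
  rcases lt_or_ge n 2 with hn | hn
  -- With fewer than two points all diagrams of clouds are empty and the loss is constant.
  · have hzero (Q : Fin n → EuclideanSpace ℝ (Fin m)) : PD 𝕜 Q = 0 := PDof_eq_zero 𝕜 hn
    have : IsEmpty (PD 𝕜 P) := by rw [hzero]; infer_instance
    simp only [hzero, lossGrad, Finset.univ_eq_empty, Finset.sum_empty]
    exact hasGradientAt_const _ _
  have : Nonempty (PD 𝕜 P) := by
    obtain ⟨z, hz⟩ := Multiset.exists_mem_of_ne_zero (PD_ne_zero 𝕜 hgen.1 hn)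
    exact ⟨⟨z, ⟨0, Multiset.count_pos.2 hz⟩⟩⟩
  have : Nonempty β := by
    obtain ⟨z, hz⟩ := Multiset.exists_mem_of_ne_zero (hβ0 hn)
    exact ⟨⟨z, ⟨0, Multiset.count_pos.2 hz⟩⟩⟩
  have hy : ∀ j, pts β j ∈ Omega := fun j => hβ _ (pts_mem β j)
  have hev := eventually_exists_PD_update_eq 𝕜 hgen i
  have hx' := hasFDerivAt_movedPts 𝕜 hgen.1 i
  have hmain := (hasFDerivAt_FGfam_sub_half_self hε hx' (hev.mono fun q h => h.1) hy).sub_const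
    (1 / 2 * FG ε β β)
  set Φ : EuclideanSpace ℝ (Fin m) → ℝ := fun q =>
    FGfam ε (movedPts 𝕜 P i q) (pts β)
      - 1 / 2 * FGfam ε (movedPts 𝕜 P i q) (movedPts 𝕜 P i q) - 1 / 2 * FG ε β β with hΦ
  obtain ⟨N, hN⟩ : ∃ N : ℕ, ∀ Q : Fin n → EuclideanSpace ℝ (Fin m), (PD 𝕜 Q).card ≤ N :=
    ⟨_, fun Q => card_PDof_le 𝕜 _⟩
  obtain ⟨l, hl, -⟩ := exists_hasFDerivAt_pers hx'
  have hpers0 : 0 < pers (movedPts 𝕜 P i (P i)) := pers_pos hev.self_of_nhds.1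
  set p₀ := pers (movedPts 𝕜 P i (P i))
  have hpy := pers_pos hy
  -- Near `P i` the total persistence of the moved points lies between `p₀ / 2` and `p₀ + 1`, and
  -- that of the extra points is below `1`; `c` and `D` are therefore uniform bounds.
  set c := min (p₀ / 2) (pers (pts β))
  have hc : 0 < c := lt_min (half_pos hpers0) hpy
  set D := max (p₀ + 2) (pers (pts β))
  set C := 2 * ((1 + ε / 2 + ε * (max N β.card : ℕ) / (2 * c)
    + ε * Real.exp (2 * D / ε) * (D / c)) * (N * 2))
  have hsmall : ∀ᶠ q in nhds (P i), N * (2 * ‖q - P i‖ ^ 2) < 1 := by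
    have h : Continuous fun q => N * (2 * ‖q - P i‖ ^ 2) := by fun_prop
    have := h.tendsto (P i)
    simp only [sub_self, norm_zero, ne_eq, OfNat.ofNat_ne_zero, not_false_eq_true, zero_pow,
      mul_zero] at this
    exact this.eventually (gt_mem_nhds one_pos)
  have hbound : ∀ᶠ q in nhds (P i),
      ‖SFG ε (PD 𝕜 (Function.update P i q)) β - Φ q‖ ≤ C * ‖‖q - P i‖ ^ 2‖ := by
    filter_upwards [hev, hsmall, hl.continuousAt.eventually (lt_mem_nhds (half_lt_self hpers0)),
      hl.continuousAt.eventually (gt_mem_nhds (lt_add_one p₀))] with q ⟨hx, R, hR, hRΩ, hRs⟩ h1 h2 h3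
    have hcard : (PD 𝕜 P).card + R.card ≤ N := by
      have := hN (Function.update P i q)
      rwa [hR, Multiset.card_add, Multiset.card_map, Finset.card_val, Finset.card_univ,
        Multiset.card_coe] at this
    have hRp : pers (pts R) ≤ N * (2 * ‖q - P i‖ ^ 2) := by
      refine (pers_pts_le R hRs).trans ?_
      have : (R.card : ℝ) ≤ N := by exact_mod_cast (Nat.le_add_left _ _).trans hcard
      gcongr
    have hkey := abs_sinkhorn_sumElim_sub_le hε hc hx (fun k => hRΩ _ (pts_mem R k)) hy
      ((min_le_left _ _).trans h2.le) (min_le_right _ _)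
      (le_trans (by linarith) (le_max_left _ _)) (le_max_right (p₀ + 2) _)
      (N := max N β.card) (by simp) (by simpa using Or.inl hcard)
    rw [SFG_eq_of_eq_add ε hR, hΦ]
    simp only [sub_sub_sub_cancel_right, norm_pow, norm_norm]
    refine hkey.trans ?_
    have hD : 0 ≤ D := hpy.le.trans (le_max_right _ _)
    calc _ ≤ 2 * ((1 + ε / 2 + ε * (max N β.card : ℕ) / (2 * c)
          + ε * Real.exp (2 * D / ε) * (D / c)) * (N * (2 * ‖q - P i‖ ^ 2))) := by gcongr
      _ = _ := by ring
  -- The extra points matter only to second order, so the derivative is that of `Φ`.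
  have hrem : HasFDerivAt (fun q => SFG ε (PD 𝕜 (Function.update P i q)) β - Φ q)
      (0 : EuclideanSpace ℝ (Fin m) →L[ℝ] ℝ) (P i) :=
    (Asymptotics.IsBigO.of_bound C hbound).hasFDerivAt one_lt_two
  rw [hasGradientAt_iff_hasFDerivAt]
  have hsum := hrem.add hmain
  refine (hsum.congr_of_eventuallyEq (Filter.Eventually.of_forall fun q => ?_)).congr_fderiv ?_
  · simp [hΦ]
  · ext v
    rw [movedPts_self]
    simp [lossGrad, zeta]

theorem Emb_movePoint (Θ : Params n m) (i : Fin n) (q : EuclideanSpace ℝ (Fin m)) :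
    Emb (Θ.movePoint i q) = Function.update (Emb Θ) i q := by
  funext j
  rcases eq_or_ne j i with rfl | h
  · simp [Emb, Params.movePoint]
  · simp [Emb, Params.movePoint, h]

end Loss
end
end TopNode2vec

theorem theorem3 (𝕜 : Type*) [Field 𝕜] {n m : ℕ} (ε γ ν : ℝ) (hε : 0 < ε) (hγ : 0 < γ) (hν : 0 < ν)
    (Θ : TopNode2vec.Params n m)
    (hgen : TopNode2vec.GeneralPosition 𝕜 (TopNode2vec.Emb Θ)) :
    (∀ β : Multiset (ℝ × ℝ), β ≠ 0 → (∀ y ∈ β, y ∈ TopNode2vec.Omega) →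
      TopNode2vec.HasUniquePlans ε (TopNode2vec.PD 𝕜 (TopNode2vec.Emb Θ)) β ∧
      ∀ i : Fin n,
        HasGradientAt (fun q => TopNode2vec.topLoss 𝕜 ε β (Θ.movePoint i q))
          (TopNode2vec.lossGrad 𝕜 (TopNode2vec.Emb Θ) ε β i) (TopNode2vec.Emb Θ i)) ∧
    (∀ G : TopNode2vec.WeightedGraph n,
      TopNode2vec.HasUniquePlans ε (TopNode2vec.PD 𝕜 (TopNode2vec.Emb Θ))
        (TopNode2vec.graphPD 𝕜 γ ν G) ∧
      ∀ i : Fin n,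
        HasGradientAt (fun q => TopNode2vec.L₁ 𝕜 ε γ ν G (Θ.movePoint i q))
          (TopNode2vec.lossGrad 𝕜 (TopNode2vec.Emb Θ) ε (TopNode2vec.graphPD 𝕜 γ ν G) i)
          (TopNode2vec.Emb Θ i)) := by
  -- Nonemptiness of `β` is asked only for `2 ≤ n`, because the diagram of a graph with fewer
  -- vertices is empty.
  have key (β : Multiset (ℝ × ℝ)) (hβ0 : 2 ≤ n → β ≠ 0) (hβ : ∀ y ∈ β, y ∈ TopNode2vec.Omega) :
      TopNode2vec.HasUniquePlans ε (TopNode2vec.PD 𝕜 (TopNode2vec.Emb Θ)) β ∧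
      ∀ i : Fin n,
        HasGradientAt (fun q => TopNode2vec.topLoss 𝕜 ε β (Θ.movePoint i q))
          (TopNode2vec.lossGrad 𝕜 (TopNode2vec.Emb Θ) ε β i) (TopNode2vec.Emb Θ i) := by
    have hx := TopNode2vec.pts_PDof_mem_Omega 𝕜
      fun a b => dist (TopNode2vec.Emb Θ a) (TopNode2vec.Emb Θ b)
    refine ⟨⟨TopNode2vec.existsUnique_isOptimalPlan hε hx fun j =>
      hβ _ (TopNode2vec.pts_mem β j), TopNode2vec.existsUnique_isOptimalPlan hε hx hx⟩, fun i => ?_⟩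
    simp only [TopNode2vec.topLoss, TopNode2vec.Emb_movePoint]
    exact TopNode2vec.hasGradientAt_SFG_PD 𝕜 hε hgen hβ hβ0 i
  exact ⟨fun β hβ0 hβ => key β (fun _ => hβ0) hβ, fun G =>
    key _ (TopNode2vec.graphPD_ne_zero 𝕜 hγ G) fun y hy => (TopNode2vec.mem_PDof 𝕜 hy).2.2⟩
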